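/- Let $G$ be a finite simple graph with vertex set $V=\{1,\dots,n\}$ and edge set $E$; for $U\subseteq V$ let $G[U]$ be the induced subgraph, and let $\mathcal A=\{U\subseteq V: |U|\ge 2\}$. For a field $K$ let $$J_G=\bigl(X_iY_j-X_jY_i : \{i,j\}\in E,\ i<j\bigr)\subseteq K[X_1,\dots,X_n,Y_1,\dots,Y_n]$$ be the binomial edge ideal of $G$. A \emph{semi-path} of $G$ is a subgraph each of whose connected components is a path (possibly a single vertex), and $r(G)$ is the maximal number of edges of a semi-path of $G$. The \emph{binomial grade} of $J_G$ is the maximal length of a regular sequence consisting of binomials that form part of a minimal (homogeneous) generating set of $J_G$. For $\Bbbk\in\{\mathbb Z,\mathbb Q\}$: * $\mathrm{PP}_{G,\Bbbk}$ is the maximum of $\sum_{e\in E}x_e$ over all $x\in\Bbbk_{\ge0}^{E}$ with $\sum_{e\in E(G[U])}x_e\le |U|-1$ for all $U\in\mathcal A$ and $\sum_{e\ni v}x_e\le 2$ for all $v\in V$; * $\mathrm{PP}^*_{G,\Bbbk}$ is the minimum of $\sum_{v\in V}2w_v+\sum_{U\in\mathcal A}(|U|-1)w_U$ over all $w\in\Bbbk_{\ge0}^{V}\times\Bbbk_{\ge0}^{\mathcal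 A}$ with $w_i+w_j+\sum_{U\in\mathcal A,\ i,j\in U}w_U\ge1$ for all $\{i,j\}\in E$; * $\mathrm{LP}_{G,\Bbbk}$ is the maximum of $\sum_{e\in E}(x_e+y_e)$ over all $x,y\in\Bbbk_{\ge0}^{E}$ with $\sum_{e\in E(G[U])}(x_e+y_e)\le|U|-1$ for all $U\in\mathcal A$ and, for all $v\in V$, $$\sum_{\{v,w\}\in E,\ v<w}x_{\{v,w\}}+\sum_{\{w,v\}\in E,\ w<v}y_{\{w,v\}}\le1,\qquad \sum_{\{v,w\}\in E,\ v<w}y_{\{v,w\}}+\sum_{\{w,v\}\in E,\ w<v}x_{\{w,v\}}\le1.$$ For an ideal $I\subseteq\mathfrak m$ of a polynomial ring over a field of characteristic $p>0$, where $\mathfrak m$ is generated by the variables and $\mathfrak m^{[q]}$ by their $q$-th powers, let $\nu_e(I)=\max\{r: I^r\not\subseteq\mathfrak m^{[p^e]}\}$; the F-threshold of $I$ is $\mathrm{ft}(I)=\lim_{e\to\infty}\nu_e(I)/p^e$. Then all of the above optimal values and maxima exist, and: 1. $\mathrm{PP}_{G,\mathbb Z}=r(G)$, and this number equals the binomial grade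 of $J_G$ over every field $K$. 2. $\mathrm{PP}^*_{G,\mathbb Z}=\operatorname{height}(J_G)$ over every field $K$. 3. $\mathrm{PP}_{G,\mathbb Q}=\mathrm{LP}_{G,\mathbb Q}$, and for every prime $p$ and every field $K$ of characteristic $p$ (in particular $K=\mathbb F_p$, where $J_G$ is written $J_{G,p}$), the limit $\mathrm{ft}(J_G)$ exists and $\mathrm{ft}(J_G)\le\mathrm{PP}_{G,\mathbb Q}=\mathrm{LP}_{G,\mathbb Q}$. -/

import Mathlib

universe u

namespace PathPacking

/-! ### Graphs: semi-paths -/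

section Graphs

variable {n : ℕ} (G : SimpleGraph (Fin n))

/-- A subgraph `P` of `G` is a semi-path if every connected component of `P` is a path
(a single vertex counts as a path): the component is exactly the subgraph traced out by some
walk without repeated vertices. -/
def IsSemiPath {G : SimpleGraph (Fin n)} (P : G.Subgraph) : Prop :=
  ∀ c : P.coe.ConnectedComponent, ∃ (a b : P.verts) (w : P.coe.Walk a b),
    w.IsPath ∧ w.toSubgraph = (⊤ : P.coe.Subgraph).induce c.supp

/-- The possible numbers of edges of semi-paths of `G`; the greatest one is `r(G)`. -/
def semiPathSizes : Set ℕ :=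
  {k | ∃ P : G.Subgraph, IsSemiPath P ∧ P.edgeSet.ncard = k}

end Graphs

/-! ### The linear programs -/

section Programs

variable {n : ℕ} (G : SimpleGraph (Fin n)) (𝕜 : Type) [CommRing 𝕜] [LinearOrder 𝕜]

open Classical in
/-- Feasibility for the path packing program `PP`: one variable for each edge of `G`. -/
structure PPFeasible (x : G.edgeSet → 𝕜) : Prop where
  nonneg : ∀ e, 0 ≤ x e
  subset_le : ∀ U : Finset (Fin n), 2 ≤ U.card →
    ∑ e ∈ (Finset.univ : Finset G.edgeSet) with (∀ v ∈ e.1, v ∈ U), x e ≤ (U.card : 𝕜) - 1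
  vertex_le : ∀ v : Fin n, ∑ e ∈ (Finset.univ : Finset G.edgeSet) with v ∈ e.1, x e ≤ 2

open Classical in
/-- The objective values of the feasible points of `PP`; the greatest one is `PP_{G,𝕜}`. -/
def ppValues : Set 𝕜 :=
  {z | ∃ x : G.edgeSet → 𝕜, PPFeasible G 𝕜 x ∧ z = ∑ e, x e}

/-- Feasibility for the dual of `PP`: variables `W v` for the vertices `v` and `WU U` for the
vertex sets `U` with at least two elements. -/
structure PPDualFeasible (W : Fin n → 𝕜) (WU : {U : Finset (Fin n) // 2 ≤ U.card} → 𝕜) :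
    Prop where
  vertex_nonneg : ∀ v, 0 ≤ W v
  subset_nonneg : ∀ U, 0 ≤ WU U
  edge_le : ∀ i j : Fin n, G.Adj i j →
    1 ≤ W i + W j + ∑ U : {U : Finset (Fin n) // 2 ≤ U.card} with i ∈ U.1 ∧ j ∈ U.1, WU U

/-- The objective values of the feasible points of the dual of `PP`; the least one is
`PP*_{G,𝕜}`. -/
def ppDualValues : Set 𝕜 :=
  {z | ∃ W WU, PPDualFeasible G 𝕜 W WU ∧
    z = ∑ v, 2 * W v + ∑ U : {U : Finset (Fin n) // 2 ≤ U.card}, ((U.1.card : 𝕜) - 1) * WU U}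

open Classical in
/-- Feasibility for the program `LP`: two variables `x e`, `y e` for each edge of `G`. -/
structure LPFeasible (x y : G.edgeSet → 𝕜) : Prop where
  x_nonneg : ∀ e, 0 ≤ x e
  y_nonneg : ∀ e, 0 ≤ y e
  subset_le : ∀ U : Finset (Fin n), 2 ≤ U.card →
    ∑ e ∈ (Finset.univ : Finset G.edgeSet) with (∀ v ∈ e.1, v ∈ U), (x e + y e) ≤ (U.card : 𝕜) - 1
  vertex_x_le : ∀ v : Fin n,
    ∑ e ∈ (Finset.univ : Finset G.edgeSet) with (∃ w, v < w ∧ e.1 = s(v, w)), x e +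
      ∑ e ∈ (Finset.univ : Finset G.edgeSet) with (∃ w, w < v ∧ e.1 = s(w, v)), y e ≤ 1
  vertex_y_le : ∀ v : Fin n,
    ∑ e ∈ (Finset.univ : Finset G.edgeSet) with (∃ w, v < w ∧ e.1 = s(v, w)), y e +
      ∑ e ∈ (Finset.univ : Finset G.edgeSet) with (∃ w, w < v ∧ e.1 = s(w, v)), x e ≤ 1

open Classical in
/-- The objective values of the feasible points of `LP`; the greatest one is `LP_{G,𝕜}`. -/
def lpValues : Set 𝕜 :=
  {z | ∃ x y : G.edgeSet → 𝕜, LPFeasible G 𝕜 x y ∧ z = ∑ e, (x e + y e)}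

end Programs

/-! ### Ideals -/

section Ideals

open MvPolynomial

/-- The binomial edge ideal `J_G` in `K[X_1, …, X_n, Y_1, …, Y_n]`, where `X_i` is the variable
`Sum.inl i` and `Y_i` is the variable `Sum.inr i`. -/
noncomputable def binomialEdgeIdeal (K : Type u) [Field K] {n : ℕ} (G : SimpleGraph (Fin n)) :
    Ideal (MvPolynomial (Fin n ⊕ Fin n) K) :=
  Ideal.span {f | ∃ i j : Fin n, i < j ∧ G.Adj i j ∧
    f = X (Sum.inl i) * X (Sum.inr j) - X (Sum.inl j) * X (Sum.inr i)}

variable {σ : Type} {K : Type u} [Field K]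

/-- `S` is a minimal generating set of the graded ideal `I`: a set of homogeneous generators
none of whose proper subsets generates `I`. -/
def IsMinimalGeneratingSet (I : Ideal (MvPolynomial σ K)) (S : Set (MvPolynomial σ K)) : Prop :=
  Minimal (fun T : Set (MvPolynomial σ K) =>
    (∀ f ∈ T, ∃ d : ℕ, f.IsHomogeneous d) ∧ Ideal.span T = I) S

/-- The lengths of the regular sequences that consist of binomials (polynomials with exactly two
terms) forming part of a minimal generating set of `I`; the greatest one is the binomial grade
of `I`. -/
def binomialRegularLengths (I : Ideal (MvPolynomial σ K)) : Set ℕ :=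
  {k | ∃ (S : Set (MvPolynomial σ K)) (rs : List (MvPolynomial σ K)),
    IsMinimalGeneratingSet I S ∧ (∀ f ∈ rs, f ∈ S ∧ f.support.card = 2) ∧
    RingTheory.Sequence.IsRegular (MvPolynomial σ K) rs ∧ rs.length = k}

/-- `𝔪^{[q]}`, the ideal generated by the `q`-th powers of the variables. -/
noncomputable def frobeniusPowerMax (σ : Type) (K : Type u) [Field K] (q : ℕ) : Ideal (MvPolynomial σ K) :=
  Ideal.span (Set.range fun i : σ => (X i : MvPolynomial σ K) ^ q)

/-- `c` is the F-threshold of `I` in characteristic `p`: the numbers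
`ν_e = max {r | I ^ r ⊄ 𝔪^{[p^e]}}` all exist, and `ν_e / p ^ e` tends to `c`. -/
def IsFThreshold (p : ℕ) (I : Ideal (MvPolynomial σ K)) (c : ℝ) : Prop :=
  ∃ ν : ℕ → ℕ, (∀ e, IsGreatest {r : ℕ | ¬ I ^ r ≤ frobeniusPowerMax σ K (p ^ e)} (ν e)) ∧
    Filter.Tendsto (fun e => (ν e : ℝ) / (p : ℝ) ^ e) Filter.atTop (nhds c)

end Ideals

end PathPacking

namespace PathPacking

/-! ### Attainment in linear programming -/

section LinearProgramming

variable {F V ι : Type*} [Field F] [LinearOrder F] [IsStrictOrderedRing F] [AddCommGroup V]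
  [Module F V] [Finite ι] (l : ι → V →ₗ[F] F) (b : ι → F) (c : V →ₗ[F] F)

/-! The link between optimization and algebra is a family of primes. For a vertex set `S` and a
partition of the remaining columns into classes, the kernel `paramIdeal` of a parametrization
contains the variables of the columns in `S` and all minors inside a class. Krull's height theorem
bounds the heights of such primes by `2|S| + ∑ (|U| - 1)`, a value of the dual objective
(`exists_isPrime_height_le`), and splitting classes one column at a time gives the matching lower
bound (`le_height_paramIdeal`).

Height: replacing an integral dual point by its support does not raise the cost, and yields such a
prime over `J_G`. Conversely, for a prime `Q` over `J_G`, the columns vanishing modulo `Q` and the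
components of the remaining graph define a `paramIdeal` inside `Q`, and their indicators are dual
feasible with value at most the height of `Q`.

Grade: the three numbers are compared in a circle. Oriented along its paths, a semi-path gives
minors with pairwise coprime leading terms `X_u Y_v`, and these form a regular sequence
(`isRegular_of_isPathOrdered`). The length of a regular sequence is at most the height of any prime
containing it, so testing it against the primes above shows that its edges satisfy all the
constraints of `PP` (`binomialRegularLengths_subset`). An integral point of `PP` in turn is the
indicator of a graph without cycles and with degrees at most two, that is, of a semi-path.

F-threshold: adding and halving variables identifies `PP` and `LP` over `ℚ`. If `J_G ^ r` is not
inside `𝔪^{[q]}`, some product of minors has a monomial with all exponents below `q`; counting which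
term of each minor was used gives the vertex constraints of `LP`. The subset constraints come from a
pigeonhole argument inside each `U` and a colon property of Frobenius powers
(`prod_minor_pow_mem_frobeniusPowerMax`). Frobenius makes `ν_e / p ^ e` monotone, so the bound also
yields the limit. -/

/-- If the objective increases along a direction in which all active constraints are constant,
then one can move in that direction until a further constraint becomes active. -/
lemma exists_more_active {M : F} (hM : ∀ x, (∀ i, l i x ≤ b i) → c x ≤ M) {x d : V}
    (hx : ∀ i, l i x ≤ b i) (hd : ∀ i, l i x = b i → l i d = 0) (hc : 0 < c d) :
    ∃ y, (∀ i, l i y ≤ b i) ∧ c x ≤ c y ∧ {i | l i x = b i} ⊂ {i | l i y = b i} := by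
  classical
  have := Fintype.ofFinite ι
  -- Only these constraints can stop a motion along `d`; if there were none, the objective would
  -- exceed `M` on the ray.
  set T : Finset ι := {i | 0 < l i d} with hT
  have hTne : T.Nonempty := by
    by_contra hne
    rw [Finset.not_nonempty_iff_eq_empty] at hne
    have hle : ∀ i, l i d ≤ 0 := by
      intro i
      by_contra h
      have : i ∈ T := by simpa [hT] using h
      simp [hne] at this
    have ht : 0 ≤ (|M - c x| + 1) / c d := by positivity
    have := hM (x + ((|M - c x| + 1) / c d) • d) (by
      intro i
      have := mul_nonpos_of_nonneg_of_nonpos ht (hle i)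
      simp only [map_add, map_smul, smul_eq_mul]
      linarith [hx i])
    simp only [map_add, map_smul, smul_eq_mul] at this
    rw [div_mul_cancel₀ _ hc.ne'] at this
    linarith [le_abs_self (M - c x)]
  -- Ratio test: `j` is a constraint that is hit first.
  obtain ⟨j, hj, hmin⟩ := T.exists_min_image (fun i => (b i - l i x) / l i d) hTne
  have hjd : 0 < l j d := by simpa [hT] using hj
  set t := (b j - l j x) / l j d with ht
  have ht0 : 0 ≤ t := div_nonneg (sub_nonneg.2 (hx j)) hjd.le
  refine ⟨x + t • d, ?_, ?_, ?_⟩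
  · intro i
    simp only [map_add, map_smul, smul_eq_mul]
    by_cases hi : 0 < l i d
    · have := hmin i (by simpa [hT] using hi)
      rw [le_div_iff₀ hi] at this
      linarith
    · have := mul_nonpos_of_nonneg_of_nonpos ht0 (not_lt.1 hi)
      linarith [hx i]
  · simp only [map_add, map_smul, smul_eq_mul]
    have := mul_nonneg ht0 hc.le
    linarith
  · rw [Set.ssubset_iff_of_subset]
    · refine ⟨j, ?_, ?_⟩
      · simp only [Set.mem_ofPred_eq, map_add, map_smul, smul_eq_mul, ht]
        rw [div_mul_cancel₀ _ hjd.ne']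
        ring
      · intro h
        exact hjd.ne' (hd j h)
    · intro i hi
      have hi' : l i x = b i := hi
      simp [hd i hi', hi']

/-- Moving along `d` or `-d`, whichever raises the objective, strictly shrinks the finite set of
inactive constraints, so the process stops. At a terminal point the objective is constant along all
directions tangent to the active constraints. -/
lemma exists_terminal {M : F} (hM : ∀ x, (∀ i, l i x ≤ b i) → c x ≤ M) (m : ℕ) :
    ∀ x, (∀ i, l i x ≤ b i) → {i | l i x ≠ b i}.ncard = m →
      ∃ y, (∀ i, l i y ≤ b i) ∧ c x ≤ c y ∧ ∀ d, (∀ i, l i y = b i → l i d = 0) → c d = 0 := by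
  induction m using Nat.strong_induction_on with
  | _ m ih =>
    intro x hx hm
    by_cases h : ∀ d, (∀ i, l i x = b i → l i d = 0) → c d = 0
    · exact ⟨x, hx, le_rfl, h⟩
    · push Not at h
      obtain ⟨d, hd, hcd⟩ := h
      obtain ⟨y, hy, hxy, hss⟩ : ∃ y, (∀ i, l i y ≤ b i) ∧ c x ≤ c y ∧
          {i | l i x = b i} ⊂ {i | l i y = b i} := by
        rcases lt_or_gt_of_ne hcd with h | h
        · exact exists_more_active l b c hM hx (d := -d) (fun i hi => by simp [hd i hi])
            (by simpa using h)
        · exact exists_more_active l b c hM hx hd h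
      have hlt : {i | l i y ≠ b i}.ncard < m := by
        rw [← hm]
        refine Set.ncard_lt_ncard ?_ (Set.toFinite _)
        have hsub : {i | l i y ≠ b i} ⊆ {i | l i x ≠ b i} := fun i hi hix => hi (hss.1 hix)
        rw [Set.ssubset_iff_of_subset hsub]
        obtain ⟨j, hj, hjx⟩ := Set.exists_of_ssubset hss
        exact ⟨j, hjx, fun h => h hj⟩
      obtain ⟨z, hz, hyz, ht⟩ := ih _ hlt y hy rfl
      exact ⟨z, hz, hxy.trans hyz, ht⟩

/-- A feasible and bounded linear program over an ordered field attains its optimum. -/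
theorem exists_isMaxOn_of_linear_constraints {M : F} (hM : ∀ x, (∀ i, l i x ≤ b i) → c x ≤ M)
    {x₀ : V} (hx₀ : ∀ i, l i x₀ ≤ b i) :
    ∃ x, (∀ i, l i x ≤ b i) ∧ ∀ y, (∀ i, l i y ≤ b i) → c y ≤ c x := by
  classical
  set A : Set V := {y | (∀ i, l i y ≤ b i) ∧ ∀ d, (∀ i, l i y = b i → l i d = 0) → c d = 0}
  have hfin : (c '' A).Finite := by
    -- The value at a terminal point depends only on its active set, hence only finitely many values
    -- occur.
    have hinj : ∀ y ∈ A, ∀ z ∈ A, {i | l i y = b i} = {i | l i z = b i} → c y = c z := by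
      intro y hy z hz h
      have := hy.2 (z - y) (fun i hi => by
        have hi' : l i z = b i := by
          have : i ∈ {i | l i z = b i} := h ▸ hi
          exact this
        rw [map_sub, hi, hi', sub_self])
      rw [map_sub, sub_eq_zero] at this
      exact this.symm
    have : ∀ v ∈ c '' A, ∃ s : Set ι, ∃ y ∈ A, c y = v ∧ {i | l i y = b i} = s := by
      rintro _ ⟨y, hy, rfl⟩
      exact ⟨_, y, hy, rfl, rfl⟩
    choose! f hf using this
    refine Set.Finite.of_injOn (f := f) (t := Set.univ) (fun _ _ => Set.mem_univ _) ?_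
      (Set.toFinite _)
    intro v hv w hw hvw
    obtain ⟨y, hy, rfl, h1⟩ := hf v hv
    obtain ⟨z, hz, rfl, h2⟩ := hf w hw
    exact hinj y hy z hz (by rw [h1, h2, hvw])
  obtain ⟨y₀, hy₀, -, ht₀⟩ := exists_terminal l b c hM _ x₀ hx₀ rfl
  obtain ⟨v, ⟨x, hx, rfl⟩, hmax⟩ :=
    hfin.exists_maximalFor id _ ⟨_, Set.mem_image_of_mem c (show y₀ ∈ A from ⟨hy₀, ht₀⟩)⟩
  refine ⟨x, hx.1, fun y hy => ?_⟩
  obtain ⟨z, hz, hyz, ht⟩ := exists_terminal l b c hM _ y hy rfl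
  refine hyz.trans ?_
  have h := hmax (j := c z) (Set.mem_image_of_mem c (show z ∈ A from ⟨hz, ht⟩))
  rcases le_total (c z) (c x) with h' | h'
  · exact h'
  · exact h h'

end LinearProgramming

/-! ### The rational path packing programs -/

section RationalPrograms

variable {n : ℕ} (G : SimpleGraph (Fin n))

open Classical in
lemma ppValues_rat_exists_isGreatest : ∃ q, IsGreatest (ppValues G ℚ) q := by
  let ι := G.edgeSet ⊕ {U : Finset (Fin n) // 2 ≤ U.card} ⊕ Fin n
  let S (s : Finset G.edgeSet) : (G.edgeSet → ℚ) →ₗ[ℚ] ℚ := ∑ e ∈ s, LinearMap.proj e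
  have hS : ∀ s x, S s x = ∑ e ∈ s, x e := by
    intro s x
    simp [S]
  let l : ι → (G.edgeSet → ℚ) →ₗ[ℚ] ℚ := fun i => match i with
    | .inl e => -LinearMap.proj e
    | .inr (.inl U) => S {e | ∀ v ∈ e.1, v ∈ U.1}
    | .inr (.inr v) => S {e | v ∈ e.1}
  let b : ι → ℚ := fun i => match i with
    | .inl _ => 0
    | .inr (.inl U) => (U.1.card : ℚ) - 1
    | .inr (.inr _) => 2
  have hfeas : ∀ x, (∀ i, l i x ≤ b i) ↔ PPFeasible G ℚ x := by
    intro x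
    constructor
    · intro h
      refine ⟨fun e => ?_, fun U hU => ?_, fun v => ?_⟩
      · simpa [l, b] using h (.inl e)
      · simpa [l, b, hS] using h (.inr (.inl ⟨U, hU⟩))
      · simpa [l, b, hS] using h (.inr (.inr v))
    · rintro ⟨h1, h2, h3⟩ (e | U | v)
      · simpa [l, b] using h1 e
      · simpa [l, b, hS] using h2 U.1 U.2
      · simpa [l, b, hS] using h3 v
  -- The constraint at one endpoint already gives `x e ≤ 2`, so the program is bounded.
  have hM : ∀ x, (∀ i, l i x ≤ b i) → S Finset.univ x ≤ ∑ _e : G.edgeSet, 2 := by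
    intro x hx
    rw [hfeas] at hx
    rw [hS]
    refine Finset.sum_le_sum fun e _ => ?_
    obtain ⟨⟨u, v⟩, he⟩ := e
    refine le_trans ?_ (hx.vertex_le u)
    refine Finset.single_le_sum (f := x) (fun e _ => hx.nonneg e) ?_
    simp
  have h0 : ∀ i, l i 0 ≤ b i := by
    rw [hfeas]
    refine ⟨fun e => le_rfl, fun U hU => ?_, fun v => ?_⟩
    · have : (2 : ℚ) ≤ U.card := by exact_mod_cast hU
      simp only [Pi.zero_apply, Finset.sum_const_zero]
      linarith
    · simp
  obtain ⟨x, hx, hmax⟩ := exists_isMaxOn_of_linear_constraints l b (S Finset.univ) hM h0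
  refine ⟨S Finset.univ x, ⟨x, (hfeas x).1 hx, hS _ _⟩, ?_⟩
  rintro z ⟨y, hy, rfl⟩
  have := hmax y ((hfeas y).2 hy)
  rwa [hS Finset.univ y] at this

open Classical in
lemma sum_mem_vertex_split (v : Fin n) (x : G.edgeSet → ℚ) :
    ∑ e ∈ (Finset.univ : Finset G.edgeSet) with v ∈ e.1, x e =
    ∑ e ∈ (Finset.univ : Finset G.edgeSet) with (∃ w, v < w ∧ e.1 = s(v, w)), x e +
      ∑ e ∈ (Finset.univ : Finset G.edgeSet) with (∃ w, w < v ∧ e.1 = s(w, v)), x e := by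
  rw [← Finset.sum_union]
  · refine Finset.sum_congr ?_ fun _ _ => rfl
    ext e
    simp only [Finset.mem_filter, Finset.mem_univ, true_and, Finset.mem_union]
    constructor
    · intro hv
      obtain ⟨w, hw⟩ := Sym2.mem_iff_exists.1 hv
      have hadj : G.Adj v w := by
        have := e.2
        rwa [hw] at this
      rcases lt_or_gt_of_ne hadj.ne with h | h
      · exact Or.inl ⟨w, h, hw⟩
      · exact Or.inr ⟨w, h, by rw [hw, Sym2.eq_swap]⟩
    · rintro (⟨w, -, hw⟩ | ⟨w, -, hw⟩) <;> simp [hw]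
  · rw [Finset.disjoint_filter]
    rintro e - ⟨w, hw, h⟩ ⟨w', hw', h'⟩
    rw [h, Sym2.eq_iff] at h'
    rcases h' with ⟨h1, h2⟩ | ⟨h1, h2⟩
    · exact absurd hw' (by simp [h1])
    · exact absurd hw (by rw [h2]; exact not_lt.2 hw'.le)

/-- From `LP` to `PP`, the two constraints at a vertex add up to the bound `2`. Back, each `x e` is
split into two equal halves, which needs division by two and hence rational values. -/
lemma lpValues_rat_eq_ppValues_rat : lpValues G ℚ = ppValues G ℚ := by
  classical
  ext z
  constructor
  · rintro ⟨x, y, h, rfl⟩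
    refine ⟨fun e => x e + y e, ⟨fun e => add_nonneg (h.x_nonneg e) (h.y_nonneg e),
      fun U hU => ?_, fun v => ?_⟩, rfl⟩
    · convert h.subset_le U hU using 2
    · have h1 := h.vertex_x_le v
      have h2 := h.vertex_y_le v
      have h3 := sum_mem_vertex_split G v x
      have h4 := sum_mem_vertex_split G v y
      rw [Finset.sum_add_distrib]
      have h5 := (congrArg₂ (· + ·) h3 h4).trans_le (show _ ≤ (2 : ℚ) by linarith)
      convert h5 using 3
  · rintro ⟨x, h, rfl⟩
    have hv : ∀ v, ∑ e ∈ (Finset.univ : Finset G.edgeSet) with (∃ w, v < w ∧ e.1 = s(v, w)),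
        x e / 2 + ∑ e ∈ (Finset.univ : Finset G.edgeSet) with (∃ w, w < v ∧ e.1 = s(w, v)),
        x e / 2 ≤ 1 := by
      intro v
      rw [← Finset.sum_div, ← Finset.sum_div, ← add_div, ← sum_mem_vertex_split G v x]
      have := h.vertex_le v
      rw [div_le_one (by norm_num)]
      convert this using 2
    refine ⟨fun e => x e / 2, fun e => x e / 2, ⟨fun e => by have := h.nonneg e; positivity,
      fun e => by have := h.nonneg e; positivity, fun U hU => ?_, fun v => ?_, fun v => ?_⟩, ?_⟩
    · simp only [add_halves]
      convert h.subset_le U hU using 2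
    · convert hv v using 3
    · convert hv v using 3
    · simp only [add_halves]

end RationalPrograms

/-! ### Determinantal primes and heights -/

section DeterminantalPrimes

open MvPolynomial

variable (K : Type u) [Field K] {n : ℕ} {γ : Type}

/-- The `2`-minor `X_i Y_j - X_j Y_i`. -/
noncomputable def minor (i j : Fin n) : MvPolynomial (Fin n ⊕ Fin n) K :=
  X (Sum.inl i) * X (Sum.inr j) - X (Sum.inl j) * X (Sum.inr i)

lemma minor_self (i : Fin n) : minor K i i = 0 := by simp [minor]

lemma minor_swap (i j : Fin n) : minor K j i = -minor K i j := by simp [minor]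

open Classical in
/-- The parametrization that kills the columns with index in `S` and makes all columns in one
fibre of `c` proportional. -/
noncomputable def paramHom (S : Finset (Fin n)) (c : Fin n → γ) :
    MvPolynomial (Fin n ⊕ Fin n) K →ₐ[K] MvPolynomial (Fin n ⊕ γ ⊕ γ) K :=
  aeval (Sum.elim
    (fun i => if i ∈ S then 0 else X (Sum.inl i) * X (Sum.inr (Sum.inl (c i))))
    (fun i => if i ∈ S then 0 else X (Sum.inl i) * X (Sum.inr (Sum.inr (c i)))))

/-- The kernel of `paramHom`. -/
noncomputable def paramIdeal (S : Finset (Fin n)) (c : Fin n → γ) :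
    Ideal (MvPolynomial (Fin n ⊕ Fin n) K) :=
  RingHom.ker (paramHom K S c)

variable {K} {S : Finset (Fin n)} {c : Fin n → γ}

instance : (paramIdeal K S c).IsPrime := RingHom.ker_isPrime _

lemma X_inl_mem_paramIdeal_iff {i : Fin n} :
    (X (Sum.inl i) : MvPolynomial _ K) ∈ paramIdeal K S c ↔ i ∈ S := by
  by_cases h : i ∈ S <;> simp [paramIdeal, paramHom, RingHom.mem_ker, h, X_ne_zero]

lemma X_inr_mem_paramIdeal_iff {i : Fin n} :
    (X (Sum.inr i) : MvPolynomial _ K) ∈ paramIdeal K S c ↔ i ∈ S := by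
  by_cases h : i ∈ S <;> simp [paramIdeal, paramHom, RingHom.mem_ker, h, X_ne_zero]

lemma minor_mem_paramIdeal {i j : Fin n} (h : c i = c j) : minor K i j ∈ paramIdeal K S c := by
  by_cases hi : i ∈ S <;> by_cases hj : j ∈ S <;>
    simp [paramIdeal, paramHom, RingHom.mem_ker, minor, hi, hj, h]
  ring

lemma minor_notMem_paramIdeal {i j : Fin n} (hi : i ∉ S) (hj : j ∉ S) (h : c i ≠ c j) :
    minor K i j ∉ paramIdeal K S c := by
  classical
  intro hmem
  have h0 : paramHom K S c (minor K i j) = 0 := hmem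
  -- Direction `(1, 0)` for the class of `i` and `(0, 1)` for that of `j`: the minor takes the value
  -- `1`.
  have h1 := congrArg (aeval (R := K) (S₁ := K) (Sum.elim (fun _ => (1 : K)) (Sum.elim
    (fun g => if g = c i then 1 else 0) (fun g => if g = c j then 1 else 0)))) h0
  simp [paramHom, minor, hi, hj, h, h.symm] at h1

lemma paramIdeal_le_ker_constantCoeff :
    paramIdeal K S c ≤ RingHom.ker (constantCoeff (σ := Fin n ⊕ Fin n) (R := K)) := by
  intro f hf
  have hf : paramHom K S c f = 0 := hf
  have h : ∀ g, constantCoeff (paramHom K S c g) = constantCoeff g := by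
    intro g
    have : (constantCoeff (R := K)).comp (paramHom K S c).toRingHom = constantCoeff := by
      refine ringHom_ext (fun r => ?_) (fun i => ?_)
      · simp
      · rcases i with i | i <;> by_cases hi : i ∈ S <;> simp [paramHom, hi]
    exact congrArg (fun φ : _ →+* K => φ g) this
  rw [RingHom.mem_ker, ← h, hf, map_zero]

/-- `paramHom` is universal among the homomorphisms to fields that kill the columns in `S`, and
make the other columns nonzero and proportional along the fibres of `c`. -/
lemma paramIdeal_le_ker {L : Type*} [Field L] [Algebra K L]
    (θ : MvPolynomial (Fin n ⊕ Fin n) K →ₐ[K] L)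
    (hS : ∀ i ∈ S, θ (X (Sum.inl i)) = 0 ∧ θ (X (Sum.inr i)) = 0)
    (hne : ∀ i ∉ S, ¬ (θ (X (Sum.inl i)) = 0 ∧ θ (X (Sum.inr i)) = 0))
    (hc : ∀ i ∉ S, ∀ j ∉ S, c i = c j → θ (minor K i j) = 0) :
    paramIdeal K S c ≤ RingHom.ker θ := by
  classical
  -- A nonzero column of the class serves as its direction; the vanishing minors make the other
  -- columns multiples of it.
  have hrep : ∀ g : γ, ∃ ab : L × L, ∀ i ∉ S, c i = g →
      ∃ z, z * ab.1 = θ (X (Sum.inl i)) ∧ z * ab.2 = θ (X (Sum.inr i)) := by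
    intro g
    by_cases hg : ∃ r ∉ S, c r = g
    · obtain ⟨r, hr, rfl⟩ := hg
      refine ⟨(θ (X (Sum.inl r)), θ (X (Sum.inr r))), fun i hi hic => ?_⟩
      have hm := hc i hi r hr hic
      simp only [minor, map_sub, map_mul, sub_eq_zero] at hm
      by_cases hx : θ (X (Sum.inl r)) = 0
      · have hy : θ (X (Sum.inr r)) ≠ 0 := fun hy => hne r hr ⟨hx, hy⟩
        refine ⟨θ (X (Sum.inr i)) / θ (X (Sum.inr r)), ?_, div_mul_cancel₀ _ hy⟩
        rw [hx, zero_mul] at hm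
        have := (mul_eq_zero.1 hm).resolve_right hy
        rw [hx, this, mul_zero]
      · refine ⟨θ (X (Sum.inl i)) / θ (X (Sum.inl r)), div_mul_cancel₀ _ hx, ?_⟩
        rw [div_mul_eq_mul_div, hm, mul_div_cancel_left₀ _ hx]
    · exact ⟨0, fun i hi hic => absurd ⟨i, hi, hic⟩ hg⟩
  choose ab hab using hrep
  have hz : ∀ i, ∃ z, i ∉ S →
      z * (ab (c i)).1 = θ (X (Sum.inl i)) ∧ z * (ab (c i)).2 = θ (X (Sum.inr i)) := by
    intro i
    by_cases hi : i ∈ S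
    · exact ⟨0, fun h => absurd hi h⟩
    · obtain ⟨z, hz⟩ := hab (c i) i hi rfl
      exact ⟨z, fun _ => hz⟩
  choose z hz using hz
  let η : MvPolynomial (Fin n ⊕ γ ⊕ γ) K →ₐ[K] L :=
    aeval (Sum.elim z (Sum.elim (fun g => (ab g).1) (fun g => (ab g).2)))
  have hη : η.comp (paramHom K S c) = θ := by
    refine MvPolynomial.algHom_ext fun i => ?_
    rcases i with i | i
    · by_cases hi : i ∈ S
      · simp [paramHom, hi, (hS i hi).1]
      · simp [paramHom, hi, η, (hz i hi).1]
    · by_cases hi : i ∈ S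
      · simp [paramHom, hi, (hS i hi).2]
      · simp [paramHom, hi, η, (hz i hi).2]
  intro f hf
  have hf : paramHom K S c f = 0 := hf
  rw [RingHom.mem_ker, ← hη, AlgHom.comp_apply, hf, map_zero]

/-- Universality applied to the fraction field of the quotient by `Q`, where vanishing means
membership in `Q`. -/
lemma paramIdeal_le_of_isPrime {Q : Ideal (MvPolynomial (Fin n ⊕ Fin n) K)} [Q.IsPrime]
    (hS : ∀ i ∈ S, X (Sum.inl i) ∈ Q ∧ X (Sum.inr i) ∈ Q)
    (hne : ∀ i ∉ S, ¬ (X (Sum.inl i) ∈ Q ∧ X (Sum.inr i) ∈ Q))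
    (hc : ∀ i ∉ S, ∀ j ∉ S, c i = c j → minor K i j ∈ Q) :
    paramIdeal K S c ≤ Q := by
  let θ : MvPolynomial (Fin n ⊕ Fin n) K →ₐ[K] FractionRing (_ ⧸ Q) :=
    (IsScalarTower.toAlgHom K (_ ⧸ Q) (FractionRing (_ ⧸ Q))).comp (Ideal.Quotient.mkₐ K Q)
  have hθ : ∀ f, θ f = 0 ↔ f ∈ Q := by
    intro f
    rw [← Ideal.Quotient.eq_zero_iff_mem]
    simp [θ]
  have := paramIdeal_le_ker (S := S) (c := c) θ (by simpa only [hθ] using hS)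
    (by simpa only [hθ] using hne) (by simpa only [hθ] using hc)
  exact fun f hf => (hθ f).1 (this hf)

/-- Proportionality is transitive through a nonzero column: both entries of column `j` times the
minor of `i, k` are combinations of the other two minors, and one of these entries is outside `Q`.
-/
lemma minor_mem_of_minor_mem {Q : Ideal (MvPolynomial (Fin n ⊕ Fin n) K)} [Q.IsPrime]
    {i j k : Fin n} (hj : ¬ (X (Sum.inl j) ∈ Q ∧ X (Sum.inr j) ∈ Q))
    (hij : minor K i j ∈ Q) (hjk : minor K j k ∈ Q) : minor K i k ∈ Q := by
  have hX : X (Sum.inl j) * minor K i k ∈ Q := by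
    have : X (Sum.inl j) * minor K i k =
        X (Sum.inl i) * minor K j k + X (Sum.inl k) * minor K i j := by
      simp only [minor]; ring
    rw [this]
    exact Q.add_mem (Q.mul_mem_left _ hjk) (Q.mul_mem_left _ hij)
  have hY : X (Sum.inr j) * minor K i k ∈ Q := by
    have : X (Sum.inr j) * minor K i k =
        X (Sum.inr i) * minor K j k + X (Sum.inr k) * minor K i j := by
      simp only [minor]; ring
    rw [this]
    exact Q.add_mem (Q.mul_mem_left _ hjk) (Q.mul_mem_left _ hij)
  by_contra h
  exact hj ⟨(Ideal.IsPrime.mem_or_mem ‹_› hX).resolve_right h,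
    (Ideal.IsPrime.mem_or_mem ‹_› hY).resolve_right h⟩

lemma minor_mem_of_reachable {Q : Ideal (MvPolynomial (Fin n ⊕ Fin n) K)} [Q.IsPrime]
    (H : SimpleGraph (Fin n)) (hH : ∀ i j, H.Adj i j →
      minor K i j ∈ Q ∧ ¬ (X (Sum.inl i) ∈ Q ∧ X (Sum.inr i) ∈ Q))
    {i j : Fin n} (h : H.Reachable i j) : minor K i j ∈ Q := by
  obtain ⟨w⟩ := h
  induction w with
  | nil => simp [minor_self]
  | cons hadj _ ih => exact minor_mem_of_minor_mem (hH _ _ hadj.symm).2 (hH _ _ hadj).1 ih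

/-- There are primes of small height that contain the columns in `S` and all minors of the
submatrices with column sets in `𝒰`. -/
lemma exists_isPrime_height_le (K : Type u) [Field K] (S : Finset (Fin n))
    (𝒰 : Finset (Finset (Fin n))) (h𝒰 : ∀ U ∈ 𝒰, U.Nonempty) :
    ∃ P : Ideal (MvPolynomial (Fin n ⊕ Fin n) K), P.IsPrime ∧
      P.height ≤ (2 * S.card + ∑ U ∈ 𝒰, (U.card - 1) : ℕ) ∧
      (∀ v, (X (Sum.inl v) ∈ P ↔ v ∈ S) ∧ (X (Sum.inr v) ∈ P ↔ v ∈ S)) ∧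
      (∀ U ∈ 𝒰, ∀ i ∈ U, ∀ j ∈ U, minor K i j ∈ P) ∧
      P ≤ RingHom.ker constantCoeff := by
  classical
  -- The sets in `𝒰` may overlap; columns outside `S` are merged along chains of sets sharing such
  -- columns.
  let H : SimpleGraph (Fin n) :=
    SimpleGraph.fromRel fun i j => i ∉ S ∧ j ∉ S ∧ ∃ U ∈ 𝒰, i ∈ U ∧ j ∈ U
  -- The base point of `U` is taken outside `S` whenever possible, so that minors can be chained
  -- through a nonzero column.
  have hc : ∀ U ∈ 𝒰, ∃ u ∈ U, u ∈ S → U ⊆ S := by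
    intro U hU
    by_cases h : U ⊆ S
    · obtain ⟨u, hu⟩ := h𝒰 U hU
      exact ⟨u, hu, fun _ => h⟩
    · obtain ⟨u, hu, huS⟩ := Finset.not_subset.1 h
      exact ⟨u, hu, fun h => absurd h huS⟩
  obtain hn | hn := isEmpty_or_nonempty (Fin n)
  · refine ⟨⊥, Ideal.isPrime_bot, by simp, isEmptyElim, fun U hU => ?_, bot_le⟩
    obtain ⟨u, -⟩ := h𝒰 U hU
    exact isEmptyElim u
  choose! u₀ hu₀ hu₀S using hc
  let P := paramIdeal K S H.connectedComponentMk
  -- Two variables for each column in `S` and, for each `U`, only the `|U| - 1` minors with the base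
  -- point: `P` is a minimal prime over these few elements.
  let s : Finset (MvPolynomial (Fin n ⊕ Fin n) K) :=
    (S.image (fun i => X (Sum.inl i)) ∪ S.image (fun i => X (Sum.inr i))) ∪
      𝒰.biUnion fun U => (U.erase (u₀ U)).image fun u => minor K (u₀ U) u
  have hsX : ∀ v ∈ S, X (Sum.inl v) ∈ s ∧ X (Sum.inr v) ∈ s := fun v hv =>
    ⟨Finset.mem_union_left _ (Finset.mem_union_left _ (Finset.mem_image_of_mem _ hv)),
      Finset.mem_union_left _ (Finset.mem_union_right _ (Finset.mem_image_of_mem _ hv))⟩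
  have hcard : s.card ≤ 2 * S.card + ∑ U ∈ 𝒰, (U.card - 1) := by
    refine (Finset.card_union_le _ _).trans (add_le_add ?_ ?_)
    · refine (Finset.card_union_le _ _).trans ?_
      rw [two_mul]
      exact add_le_add Finset.card_image_le Finset.card_image_le
    · refine Finset.card_biUnion_le.trans (Finset.sum_le_sum fun U hU => ?_)
      exact Finset.card_image_le.trans (Finset.card_erase_of_mem (hu₀ U hU)).le
  have hPU : ∀ U ∈ 𝒰, ∀ i ∈ U, ∀ j ∈ U, minor K i j ∈ P := by
    intro U hU i hi j hj
    by_cases hiS : i ∈ S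
    · exact P.sub_mem (P.mul_mem_right _ (X_inl_mem_paramIdeal_iff.2 hiS))
        (P.mul_mem_left _ (X_inr_mem_paramIdeal_iff.2 hiS))
    by_cases hjS : j ∈ S
    · exact P.sub_mem (P.mul_mem_left _ (X_inr_mem_paramIdeal_iff.2 hjS))
        (P.mul_mem_right _ (X_inl_mem_paramIdeal_iff.2 hjS))
    refine minor_mem_paramIdeal ?_
    by_cases hij : i = j
    · rw [hij]
    · refine SimpleGraph.ConnectedComponent.sound (SimpleGraph.Adj.reachable ?_)
      rw [SimpleGraph.fromRel_adj]
      exact ⟨hij, Or.inl ⟨hiS, hjS, U, hU, hi, hj⟩⟩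
  refine ⟨P, inferInstanceAs (paramIdeal K S _).IsPrime, ?_,
    fun v => ⟨X_inl_mem_paramIdeal_iff, X_inr_mem_paramIdeal_iff⟩, hPU,
    paramIdeal_le_ker_constantCoeff⟩
  refine (Ideal.height_le_card_of_mem_minimalPrimes_span_finset (s := s) ?_).trans
    (by exact_mod_cast hcard)
  refine ⟨⟨inferInstanceAs (paramIdeal K S _).IsPrime, ?_⟩, ?_⟩
  · rw [Ideal.span_le]
    intro f hf
    simp only [s, Finset.coe_union, Set.mem_union, Finset.mem_coe, Finset.mem_image,
      Finset.mem_biUnion, Finset.mem_erase] at hf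
    rcases hf with (⟨i, hi, rfl⟩ | ⟨i, hi, rfl⟩) | ⟨U, hU, u, ⟨-, hu⟩, rfl⟩
    · exact X_inl_mem_paramIdeal_iff.2 hi
    · exact X_inr_mem_paramIdeal_iff.2 hi
    · exact hPU U hU _ (hu₀ U hU) _ hu
  · rintro Q ⟨hQ, hsQ⟩ hQP
    have hsQ' : ∀ f ∈ s, f ∈ Q := fun f hf => hsQ (Ideal.subset_span hf)
    -- Since `Q ≤ P`, columns outside `S` stay nonzero modulo `Q`; this forces the remaining minors
    -- into `Q`.
    have hne : ∀ i ∉ S, ¬ (X (Sum.inl i) ∈ Q ∧ X (Sum.inr i) ∈ Q) :=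
      fun i hi h => hi (X_inl_mem_paramIdeal_iff.1 (hQP h.1))
    have hstar : ∀ U ∈ 𝒰, ∀ i ∈ U, minor K (u₀ U) i ∈ Q := by
      intro U hU i hi
      by_cases hiu : i = u₀ U
      · rw [hiu, minor_self]
        exact Q.zero_mem
      · refine hsQ' _ (Finset.mem_union_right _ (Finset.mem_biUnion.2 ⟨U, hU, ?_⟩))
        exact Finset.mem_image_of_mem _ (Finset.mem_erase.2 ⟨hiu, hi⟩)
    have hUQ : ∀ U ∈ 𝒰, ∀ i ∈ U, ∀ j ∈ U, i ∉ S → minor K i j ∈ Q := by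
      intro U hU i hi j hj hiS
      refine minor_mem_of_minor_mem (hne (u₀ U) fun h => hiS (hu₀S U hU h hi)) ?_
        (hstar U hU j hj)
      rw [minor_swap]
      exact Q.neg_mem (hstar U hU i hi)
    refine paramIdeal_le_of_isPrime (fun i hi => ⟨hsQ' _ (hsX i hi).1, hsQ' _ (hsX i hi).2⟩) hne ?_
    intro i _ j _ hij
    refine minor_mem_of_reachable H (fun a b hab => ?_) (SimpleGraph.ConnectedComponent.exact hij)
    rw [SimpleGraph.fromRel_adj] at hab
    obtain ⟨-, ⟨ha, hb, U, hU, haU, hbU⟩ | ⟨hb, ha, U, hU, hbU, haU⟩⟩ := hab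
    · exact ⟨hUQ U hU a haU b hbU ha, hne a ha⟩
    · exact ⟨hUQ U hU a haU b hbU ha, hne a ha⟩

/-- The kernels of the substitutions killing more and more variables of `T` form a strict chain of
primes ending inside `Q`. -/
lemma card_le_height_of_X_mem {σ : Type} (T : Finset σ) {Q : Ideal (MvPolynomial σ K)} [Q.IsPrime]
    (hT : ∀ t ∈ T, X t ∈ Q) : (T.card : ℕ∞) ≤ Q.height := by
  classical
  let φ (T : Finset σ) : MvPolynomial σ K →ₐ[K] MvPolynomial σ K :=
    aeval fun t => if t ∈ T then 0 else X t
  have hle : ∀ (T : Finset σ) (Q : Ideal (MvPolynomial σ K)), (∀ t ∈ T, X t ∈ Q) →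
      RingHom.ker (φ T) ≤ Q := by
    intro T Q hT f hf
    have hf : φ T f = 0 := hf
    have : (Ideal.Quotient.mkₐ K Q).comp (φ T) = Ideal.Quotient.mkₐ K Q := by
      refine MvPolynomial.algHom_ext fun t => ?_
      by_cases ht : t ∈ T
      · simp only [AlgHom.comp_apply, φ, aeval_X, ht, if_true, map_zero]
        exact (Ideal.Quotient.eq_zero_iff_mem.2 (hT t ht)).symm
      · simp [φ, ht]
    rw [← Ideal.Quotient.eq_zero_iff_mem]
    have h := congrArg (fun ψ => ψ f) this
    simp only [AlgHom.comp_apply, hf, map_zero] at h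
    exact h.symm
  refine le_trans ?_ (Ideal.height_mono (hle T Q hT))
  clear hT
  induction T using Finset.induction_on with
  | empty => simp
  | insert t T ht ih =>
    have : (RingHom.ker (φ T)).IsPrime := RingHom.ker_isPrime _
    have : (RingHom.ker (φ (insert t T))).IsPrime := RingHom.ker_isPrime _
    have hlt : RingHom.ker (φ T) < RingHom.ker (φ (insert t T)) := by
      refine lt_of_le_of_ne (hle _ _ fun s hs => ?_) fun h => ?_
      · simp [RingHom.mem_ker, φ, hs]
      · have : X t ∈ RingHom.ker (φ T) := by
          rw [h]
          simp [RingHom.mem_ker, φ]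
        simp [RingHom.mem_ker, φ, ht, X_ne_zero] at this
    rw [Finset.card_insert_of_notMem ht]
    push_cast
    exact (add_le_add_left ih 1).trans (Ideal.height_add_one_le_of_lt_of_isPrime hlt)

/-- The number `m` counts columns in excess of one per class. Moving a column out of a class with
several members into a new class gives a strictly smaller prime; without excess, the `2|S|`
variables suffice. Labels in `ℕ` ensure that a fresh one always exists. -/
lemma le_height_paramIdeal (S : Finset (Fin n)) (m : ℕ) : ∀ c : Fin n → ℕ,
    (Sᶜ.image c).card + m = Sᶜ.card →
      ((2 * S.card + m : ℕ) : ℕ∞) ≤ (paramIdeal K S c).height := by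
  induction m with
  | zero =>
    intro c _
    have h := card_le_height_of_X_mem (K := K) (S.disjSum S) (Q := paramIdeal K S c) (by
      rintro (t | t) ht
      · exact X_inl_mem_paramIdeal_iff.2 (by simpa using ht)
      · exact X_inr_mem_paramIdeal_iff.2 (by simpa using ht))
    rwa [Finset.card_disjSum, ← two_mul] at h
  | succ m ih =>
    intro c hcm
    obtain ⟨i, hi, j, hj, hij, hcij⟩ : ∃ i ∈ Sᶜ, ∃ j ∈ Sᶜ, i ≠ j ∧ c i = c j :=
      Finset.exists_ne_map_eq_of_card_image_lt (by omega)
    obtain ⟨t, ht⟩ := Infinite.exists_notMem_finset (Sᶜ.image c)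
    have ht' : ∀ k ∉ S, c k ≠ t := fun k hk h =>
      ht (Finset.mem_image.2 ⟨k, Finset.mem_compl.2 hk, h⟩)
    let c' := Function.update c i t
    have himg : Sᶜ.image c' = insert t (Sᶜ.image c) := by
      ext x
      simp only [Finset.mem_image, Finset.mem_insert, c']
      constructor
      · rintro ⟨k, hk, rfl⟩
        by_cases hki : k = i
        · simp [hki]
        · exact Or.inr ⟨k, hk, by simp [hki]⟩
      · rintro (rfl | ⟨k, hk, rfl⟩)
        · exact ⟨i, hi, by simp⟩
        · by_cases hki : k = i
          · exact ⟨j, hj, by simp [hij.symm, hki, hcij]⟩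
          · exact ⟨k, hk, by simp [hki]⟩
    have hi' : i ∉ S := Finset.mem_compl.1 hi
    have hj' : j ∉ S := Finset.mem_compl.1 hj
    have h := ih c' (by
      rw [himg, Finset.card_insert_of_notMem ht]
      omega)
    have hlt : paramIdeal K S c' < paramIdeal K S c := by
      refine lt_of_le_of_ne (paramIdeal_le_of_isPrime
        (fun k hk => ⟨X_inl_mem_paramIdeal_iff.2 hk, X_inr_mem_paramIdeal_iff.2 hk⟩)
        (fun k hk h => hk (X_inl_mem_paramIdeal_iff.1 h.1)) fun k hk l hl hkl => ?_) fun h => ?_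
      · refine minor_mem_paramIdeal ?_
        simp only [c', Function.update_apply] at hkl
        split_ifs at hkl with h1 h2 h2
        · rw [h1, h2]
        · exact absurd hkl.symm (ht' l hl)
        · exact absurd hkl (ht' k hk)
        · exact hkl
      · have h1 : minor K i j ∈ paramIdeal K S c := minor_mem_paramIdeal hcij
        rw [← h] at h1
        refine minor_notMem_paramIdeal hi' hj' ?_ h1
        simp only [c', Function.update_self, Function.update_of_ne hij.symm]
        exact (ht' j hj').symm
    calc ((2 * S.card + (m + 1) : ℕ) : ℕ∞) = ((2 * S.card + m : ℕ) : ℕ∞) + 1 := by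
          push_cast; ring
      _ ≤ (paramIdeal K S c').height + 1 := add_le_add_left h 1
      _ ≤ _ := Ideal.height_add_one_le_of_lt_of_isPrime hlt

end DeterminantalPrimes

/-! ### The height of a binomial edge ideal -/

section Height

open MvPolynomial

variable {n : ℕ} (G : SimpleGraph (Fin n))

lemma minor_mem_binomialEdgeIdeal (K : Type u) [Field K] {i j : Fin n} (h : G.Adj i j) :
    minor K i j ∈ binomialEdgeIdeal K G := by
  rcases lt_or_gt_of_ne h.ne with hij | hij
  · exact Ideal.subset_span ⟨i, j, hij, h, rfl⟩
  · rw [minor_swap]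
    exact (Ideal.neg_mem_iff _).2 (Ideal.subset_span ⟨j, i, hij, h.symm, rfl⟩)

lemma binomialEdgeIdeal_le_iff (K : Type u) [Field K]
    {Q : Ideal (MvPolynomial (Fin n ⊕ Fin n) K)} :
    binomialEdgeIdeal K G ≤ Q ↔ ∀ i j, G.Adj i j → minor K i j ∈ Q := by
  constructor
  · intro h i j hij
    exact h (minor_mem_binomialEdgeIdeal G K hij)
  · intro h
    rw [binomialEdgeIdeal, Ideal.span_le]
    rintro _ ⟨i, j, -, hij, rfl⟩
    exact h i j hij

-- Only the supports of `W` and `WU` enter the prime: a nonzero nonnegative integer is at least one,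
-- so its height is still bounded by the objective.
variable {G} in
lemma PPDualFeasible.exists_isPrime {W : Fin n → ℤ}
    {WU : {U : Finset (Fin n) // 2 ≤ U.card} → ℤ} (h : PPDualFeasible G ℤ W WU)
    (K : Type u) [Field K] {m : ℕ}
    (hm : (m : ℤ) = ∑ v, 2 * W v +
      ∑ U : {U : Finset (Fin n) // 2 ≤ U.card}, ((U.1.card : ℤ) - 1) * WU U) :
    ∃ P : Ideal (MvPolynomial (Fin n ⊕ Fin n) K), P.IsPrime ∧ P.height ≤ m ∧
      binomialEdgeIdeal K G ≤ P := by
  classical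
  let S : Finset (Fin n) := {v | W v ≠ 0}
  let 𝒱 : Finset {U : Finset (Fin n) // 2 ≤ U.card} := {U | WU U ≠ 0}
  obtain ⟨P, hP, hPh, hPS, hPU, -⟩ := exists_isPrime_height_le K S
    (𝒱.map (Function.Embedding.subtype _)) (by
      intro U hU
      obtain ⟨U, -, rfl⟩ := Finset.mem_map.1 hU
      exact Finset.card_pos.1 (by have := U.2; simp only [Function.Embedding.subtype_apply]; omega))
  refine ⟨P, hP, hPh.trans ?_, ?_⟩
  · rw [Finset.sum_map]
    simp only [Function.Embedding.subtype_apply]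
    suffices hle : ((2 * S.card + ∑ U ∈ 𝒱, (U.1.card - 1) : ℕ) : ℤ) ≤ m by
      exact_mod_cast hle
    rw [hm]
    push_cast
    refine add_le_add ?_ ?_
    · rw [← Finset.mul_sum, Finset.card_eq_sum_ones, Finset.sum_filter]
      push_cast
      refine mul_le_mul_of_nonneg_left (Finset.sum_le_sum fun v _ => ?_) (by norm_num)
      have := h.vertex_nonneg v
      split_ifs <;> omega
    · rw [Finset.sum_filter]
      refine Finset.sum_le_sum fun U _ => ?_
      have h1 := h.subset_nonneg U
      have h2 := U.2
      rw [Nat.cast_sub (by omega)]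
      split_ifs with h0
      · exact le_mul_of_one_le_right (by push_cast; omega) (by omega)
      · exact mul_nonneg (by omega) h1
  · rw [binomialEdgeIdeal_le_iff]
    intro i j hij
    have he := h.edge_le i j hij
    by_cases hi : i ∈ S
    · exact P.sub_mem (P.mul_mem_right _ ((hPS i).1.2 hi)) (P.mul_mem_left _ ((hPS i).2.2 hi))
    by_cases hj : j ∈ S
    · exact P.sub_mem (P.mul_mem_left _ ((hPS j).2.2 hj)) (P.mul_mem_right _ ((hPS j).1.2 hj))
    have hWi : W i = 0 := by simpa [S] using hi
    have hWj : W j = 0 := by simpa [S] using hj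
    rw [hWi, hWj, zero_add, zero_add] at he
    obtain ⟨U, hU, hne⟩ := Finset.exists_ne_zero_of_sum_ne_zero (zero_lt_one.trans_le he).ne'
    rw [Finset.mem_filter] at hU
    exact hPU U.1 (Finset.mem_map.2 ⟨U, by simp [𝒱, hne], rfl⟩) i hU.2.1 j hU.2.2

/-- A prime over the binomial edge ideal yields a dual feasible point. -/
lemma exists_ppDualValue_le_height (K : Type u) [Field K]
    (Q : Ideal (MvPolynomial (Fin n ⊕ Fin n) K)) [Q.IsPrime] (hQ : binomialEdgeIdeal K G ≤ Q) :
    ∃ m : ℕ, (m : ℤ) ∈ ppDualValues G ℤ ∧ (m : ℕ∞) ≤ Q.height := by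
  classical
  rw [binomialEdgeIdeal_le_iff] at hQ
  -- The columns that vanish modulo `Q`. Along the edges avoiding `S` columns are proportional,
  -- hence so are they on the components of `H`.
  let S : Finset (Fin n) := {i | X (Sum.inl i) ∈ Q ∧ X (Sum.inr i) ∈ Q}
  have hS : ∀ i, i ∈ S ↔ X (Sum.inl i) ∈ Q ∧ X (Sum.inr i) ∈ Q := fun i => by simp [S]
  let H : SimpleGraph (Fin n) := G ⊓ SimpleGraph.fromRel fun i j => i ∉ S ∧ j ∉ S
  have hH : ∀ i j, H.Adj i j ↔ G.Adj i j ∧ i ∉ S ∧ j ∉ S := by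
    intro i j
    simp only [H, SimpleGraph.inf_adj, SimpleGraph.fromRel_adj]
    constructor
    · rintro ⟨h1, -, h | h⟩
      · exact ⟨h1, h⟩
      · exact ⟨h1, h.symm⟩
    · rintro ⟨h1, h⟩
      exact ⟨h1, h1.ne, Or.inl h⟩
  let c : Fin n → ℕ := fun i => (Finite.equivFin H.ConnectedComponent (H.connectedComponentMk i)).1
  have hc : ∀ i j, c i = c j → H.Reachable i j := by
    intro i j hij
    refine SimpleGraph.ConnectedComponent.exact ?_
    exact (Finite.equivFin H.ConnectedComponent).injective (Fin.ext hij)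
  have hcadj : ∀ i j, H.Adj i j → c i = c j := by
    intro i j hij
    simp only [c]
    rw [SimpleGraph.ConnectedComponent.sound hij.reachable]
  have hPQ : paramIdeal K S c ≤ Q := by
    refine paramIdeal_le_of_isPrime (fun i hi => (hS i).1 hi) (fun i hi h => hi ((hS i).2 h)) ?_
    intro i _ j _ hij
    refine minor_mem_of_reachable H (fun a b hab => ?_) (hc i j hij)
    rw [hH] at hab
    exact ⟨hQ a b hab.1, fun h => hab.2.1 ((hS a).2 h)⟩
  let cl : ℕ → Finset (Fin n) := fun k => {i ∈ Sᶜ | c i = k}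
  let k := (Sᶜ.image c).card
  have hk : k ≤ Sᶜ.card := Finset.card_image_le
  refine ⟨2 * S.card + (Sᶜ.card - k), ?_,
    (le_height_paramIdeal S _ c (by simp only [k] at hk ⊢; omega)).trans (Ideal.height_mono hPQ)⟩
  let 𝒰 : Finset (Finset (Fin n)) := (Sᶜ.image c).image cl
  refine ⟨fun v => if v ∈ S then 1 else 0, fun U => if U.1 ∈ 𝒰 then 1 else 0,
    ⟨fun v => by split_ifs <;> norm_num, fun U => by split_ifs <;> norm_num, ?_⟩, ?_⟩
  · intro i j hij
    by_cases hi : i ∈ S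
    · simp only [hi, if_true]
      have h1 : (0 : ℤ) ≤ if j ∈ S then 1 else 0 := by split_ifs <;> norm_num
      have h2 : (0 : ℤ) ≤ ∑ U : {U : Finset (Fin n) // 2 ≤ U.card} with i ∈ U.1 ∧ j ∈ U.1,
          if U.1 ∈ 𝒰 then 1 else 0 :=
        Finset.sum_nonneg fun U _ => by split_ifs <;> norm_num
      linarith
    by_cases hj : j ∈ S
    · simp only [hj, if_true]
      have h1 : (0 : ℤ) ≤ if i ∈ S then 1 else 0 := by simp [hi]
      have h2 : (0 : ℤ) ≤ ∑ U : {U : Finset (Fin n) // 2 ≤ U.card} with i ∈ U.1 ∧ j ∈ U.1,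
          if U.1 ∈ 𝒰 then 1 else 0 :=
        Finset.sum_nonneg fun U _ => by split_ifs <;> norm_num
      linarith
    simp only [hi, hj, if_false, zero_add]
    have hic : i ∈ cl (c i) := by simp [cl, hi]
    have hjc : j ∈ cl (c i) := by simp [cl, hj, hcadj i j ((hH i j).2 ⟨hij, hi, hj⟩)]
    have h2 : 2 ≤ (cl (c i)).card :=
      Finset.one_lt_card.2 ⟨i, hic, j, hjc, hij.ne⟩
    have hmem : cl (c i) ∈ 𝒰 :=
      Finset.mem_image_of_mem _ (Finset.mem_image_of_mem _ (Finset.mem_compl.2 hi))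
    refine le_trans (by simp [hmem]) (Finset.single_le_sum (a := ⟨cl (c i), h2⟩)
      (f := fun U : {U : Finset (Fin n) // 2 ≤ U.card} => if U.1 ∈ 𝒰 then (1 : ℤ) else 0)
      (fun U _ => by split_ifs <;> norm_num) ?_)
    simp [hic, hjc]
  · have hne : ∀ x ∈ Sᶜ.image c, (cl x).Nonempty := by
      intro x hx
      obtain ⟨i, hi, rfl⟩ := Finset.mem_image.1 hx
      exact ⟨i, Finset.mem_filter.2 ⟨hi, rfl⟩⟩
    have hinj : Set.InjOn cl (Sᶜ.image c : Finset ℕ) := by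
      intro x hx y hy hxy
      obtain ⟨i, hi⟩ := hne x hx
      have hi' : i ∈ cl y := hxy ▸ hi
      exact (Finset.mem_filter.1 hi).2.symm.trans (Finset.mem_filter.1 hi').2
    -- Classes with a single vertex are not variables of the program, but they would contribute `1 -
    -- 1 = 0`.
    have hsum : ∑ U : {U : Finset (Fin n) // 2 ≤ U.card},
        ((U.1.card : ℤ) - 1) * (if U.1 ∈ 𝒰 then 1 else 0) = ∑ U ∈ 𝒰, ((U.card : ℤ) - 1) := by
      simp only [mul_ite, mul_one, mul_zero]
      rw [← Finset.sum_subtype (s := {U : Finset (Fin n) | 2 ≤ U.card})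
        (f := fun U : Finset (Fin n) => if U ∈ 𝒰 then (U.card : ℤ) - 1 else 0) (by simp),
        Finset.sum_ite_mem]
      refine Finset.sum_subset Finset.inter_subset_right fun U hU hU' => ?_
      obtain ⟨x, hx, rfl⟩ := Finset.mem_image.1 hU
      have h1 := Finset.card_pos.2 (hne x hx)
      have h2 : ¬ 2 ≤ (cl x).card := fun h => hU' (by simp [h, hU])
      omega
    have hcl : ∑ U ∈ 𝒰, ((U.card : ℤ) - 1) = Sᶜ.card - k := by
      rw [Finset.sum_image hinj, Finset.sum_sub_distrib]
      congr 1
      · rw [Finset.card_eq_sum_card_image c Sᶜ]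
        push_cast
        rfl
      · simp [k]
    rw [hsum, hcl, ← Finset.mul_sum, Finset.sum_ite_mem]
    simp only [Finset.univ_inter, Finset.sum_const, nsmul_eq_mul, mul_one]
    push_cast [hk]
    ring

/-- The integer dual optimum is the height of the binomial edge ideal. -/
theorem exists_isLeast_ppDualValues_and_height_eq :
    ∃ h : ℕ, IsLeast (ppDualValues G ℤ) (h : ℤ) ∧
      ∀ (K : Type u) [Field K], (binomialEdgeIdeal K G).height = (h : ℕ∞) := by
  have hnonneg : ∀ z ∈ ppDualValues G ℤ, 0 ≤ z := by
    rintro _ ⟨W, WU, h, rfl⟩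
    refine add_nonneg (Finset.sum_nonneg fun v _ => ?_) (Finset.sum_nonneg fun U _ => ?_)
    · have := h.vertex_nonneg v
      omega
    · have := U.2
      exact mul_nonneg (by omega) (h.subset_nonneg U)
  have hne : ∃ z, z ∈ ppDualValues G ℤ := by
    refine ⟨_, fun _ => 1, fun _ => 0, ⟨fun _ => by norm_num, fun _ => le_rfl, fun i j _ => ?_⟩, rfl⟩
    simp
  obtain ⟨z, hz, hmin⟩ := Int.exists_least_of_bdd ⟨0, hnonneg⟩ hne
  lift z to ℕ using hnonneg z hz with h
  refine ⟨h, ⟨hz, hmin⟩, fun K _ => le_antisymm ?_ ?_⟩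
  · obtain ⟨W, WU, hW, he⟩ := hz
    obtain ⟨P, -, hPh, hJP⟩ := hW.exists_isPrime K he
    exact (Ideal.height_mono hJP).trans hPh
  · rw [Ideal.height_eq_inf_minimalPrimes]
    refine le_iInf₂ fun Q hQ => ?_
    have := hQ.1.1
    obtain ⟨m, hm, hmQ⟩ := exists_ppDualValue_le_height G K Q hQ.1.2
    refine le_trans ?_ hmQ
    have := hmin m hm
    exact_mod_cast this

end Height

/-! ### Regular sequences of binomials -/

section WeightedComponents

open MvPolynomial

variable {σ : Type} {K : Type u} [Field K] {w : σ → ℕ}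

lemma weightedHomogeneousComponent_mul_left {d : ℕ} {t : MvPolynomial σ K}
    (ht : IsWeightedHomogeneous w t d) (g : MvPolynomial σ K) (k : ℕ) :
    weightedHomogeneousComponent w k (t * g) =
      if d ≤ k then t * weightedHomogeneousComponent w (k - d) g else 0 := by
  induction g using MvPolynomial.induction_on' with
  | monomial u r =>
    have hm := isWeightedHomogeneous_monomial (R := K) w u r rfl
    have hp := ht.mul hm
    rw [weightedHomogeneousComponent_of_mem hp, weightedHomogeneousComponent_of_mem hm]
    by_cases hdk : d ≤ k
    · by_cases h : k = d + Finsupp.weight w u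
      · have : k - d = Finsupp.weight w u := by omega
        simp [h]
      · have : k - d ≠ Finsupp.weight w u := by omega
        simp [h, this]
    · rw [if_neg hdk, if_neg (by omega)]
  | add p q hp hq =>
    rw [mul_add, map_add, hp, hq]
    split_ifs
    · rw [map_add, mul_add]
    · simp

lemma weightedHomogeneousComponent_mem_span {s : Set (MvPolynomial σ K)}
    (hs : ∀ t ∈ s, ∃ d, IsWeightedHomogeneous w t d) {g : MvPolynomial σ K}
    (hg : g ∈ Ideal.span s) (k : ℕ) : weightedHomogeneousComponent w k g ∈ Ideal.span s := by
  induction hg using Submodule.span_induction generalizing k with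
  | mem t ht =>
    obtain ⟨d, hd⟩ := hs t ht
    rw [weightedHomogeneousComponent_of_mem hd]
    split_ifs
    · exact Ideal.subset_span ht
    · exact Ideal.zero_mem _
  | zero => simp
  | add p q _ _ hp hq =>
    rw [map_add]
    exact Ideal.add_mem _ (hp k) (hq k)
  | smul a p _ hp =>
    induction a using MvPolynomial.induction_on' generalizing k with
    | monomial u r =>
      rw [smul_eq_mul, weightedHomogeneousComponent_mul_left
        (isWeightedHomogeneous_monomial (R := K) w u r rfl)]
      split_ifs
      · exact Ideal.mul_mem_left _ _ (hp _)
      · exact Ideal.zero_mem _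
    | add a b ha hb =>
      rw [add_smul, map_add]
      exact Ideal.add_mem _ (ha k) (hb k)

/-- If the top weight component `t` of `t + l` is a nonzerodivisor modulo a homogeneous ideal, then
so is `t + l`. -/
lemma mem_of_add_mul_mem {s : Set (MvPolynomial σ K)}
    (hs : ∀ t ∈ s, ∃ d, IsWeightedHomogeneous w t d) {t l : MvPolynomial σ K}
    (ht : IsWeightedHomogeneous w t 1) (hl : IsWeightedHomogeneous w l 0)
    (hreg : ∀ g, t * g ∈ Ideal.span s → g ∈ Ideal.span s) {g : MvPolynomial σ K}
    (hg : (t + l) * g ∈ Ideal.span s) : g ∈ Ideal.span s := by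
  have hcomp : ∀ k, t * weightedHomogeneousComponent w k g +
      l * weightedHomogeneousComponent w (k + 1) g ∈ Ideal.span s := by
    intro k
    have := weightedHomogeneousComponent_mem_span hs hg (k + 1)
    rw [add_mul, map_add, weightedHomogeneousComponent_mul_left ht,
      weightedHomogeneousComponent_mul_left hl] at this
    simpa using this
  -- Descending induction on the weight, starting above the top weight of `g`: once the component of
  -- weight `k + 1` is in the ideal, `hcomp` leaves only `t` times the component of weight `k`.
  have hall : ∀ m k, weightedTotalDegree w g < k + m →
      weightedHomogeneousComponent w k g ∈ Ideal.span s := by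
    intro m
    induction m with
    | zero =>
      intro k hk
      rw [weightedHomogeneousComponent_eq_zero _ _ (by simpa using hk)]
      exact Ideal.zero_mem _
    | succ m ih =>
      intro k hk
      refine hreg _ ?_
      have h := Ideal.mul_mem_left _ l (ih (k + 1) (by omega))
      exact (Submodule.add_mem_iff_left _ h).1 (hcomp k)
  rw [← finsum_weightedHomogeneousComponent w g]
  exact finsum_induction (· ∈ Ideal.span s) (Ideal.zero_mem _) (fun _ _ => Ideal.add_mem _)
    fun k => hall (weightedTotalDegree w g + 1) k (by omega)

end WeightedComponents

/-! ### Minors along ordered edges -/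

section Regular

open MvPolynomial

variable {n : ℕ} {K : Type u} [Field K]

/-- A list of oriented edges, built from right to left, such that the head of each new edge is
untouched before, and its tail has not been a tail before. -/
def IsPathOrdered : List (Fin n × Fin n) → Prop
  | [] => True
  | e :: L => IsPathOrdered L ∧ e.1 ≠ e.2 ∧ ∀ e' ∈ L, e'.1 ≠ e.2 ∧ e'.2 ≠ e.2 ∧ e'.1 ≠ e.1

/-- The variables that do not divide the leading monomials `X_u Y_v` of the minors of `L`. -/
def freeVars (L : List (Fin n × Fin n)) : Set (Fin n ⊕ Fin n) :=
  {z | ∀ e ∈ L, z ≠ Sum.inl e.1 ∧ z ≠ Sum.inr e.2}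

lemma freeVars_cons_subset (e : Fin n × Fin n) (L : List (Fin n × Fin n)) :
    freeVars (e :: L) ⊆ freeVars L := fun _ hz e' he' => hz e' (List.mem_cons_of_mem _ he')

variable (K) in
/-- The minor of an edge, with the sign for which the smaller index comes first. -/
noncomputable def edgeMinor (e : Fin n × Fin n) : MvPolynomial (Fin n ⊕ Fin n) K :=
  if e.1 < e.2 then minor K e.1 e.2 else minor K e.2 e.1

lemma edgeMinor_eq_or (e : Fin n × Fin n) :
    edgeMinor K e = minor K e.1 e.2 ∨ edgeMinor K e = -minor K e.1 e.2 := by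
  rw [edgeMinor]
  split_ifs
  · exact Or.inl rfl
  · exact Or.inr (minor_swap K _ _)

lemma constantCoeff_minor (i j : Fin n) : constantCoeff (minor K i j) = 0 := by simp [minor]

variable (K) in
/-- The minors of `L` and the variables in `T`. -/
def pathGens (L : List (Fin n × Fin n)) (T : Set (Fin n ⊕ Fin n)) :
    Set (MvPolynomial (Fin n ⊕ Fin n) K) :=
  edgeMinor K '' {e | e ∈ L} ∪ X '' T

/-- Give `Y_v` weight one and all other variables weight zero. Neither the minors of `L` nor the
variables in `T` involve `Y_v`, and the top part of the new minor is `X_u Y_v`, whose two factors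
are free for `L` and thus cancel by `ih`. This cancellation is a hypothesis because the lemma is
also used inside the induction that proves it. -/
lemma edgeMinor_mul_mem {e : Fin n × Fin n} {L : List (Fin n × Fin n)}
    (h : IsPathOrdered (e :: L)) {T : Set (Fin n ⊕ Fin n)} (hT : T ⊆ freeVars (e :: L))
    (ih : ∀ T ⊆ freeVars L, ∀ z ∈ freeVars L, z ∉ T → ∀ g : MvPolynomial (Fin n ⊕ Fin n) K,
      X z * g ∈ Ideal.span (pathGens K L T) → g ∈ Ideal.span (pathGens K L T))
    {g : MvPolynomial (Fin n ⊕ Fin n) K}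
    (hg : edgeMinor K e * g ∈ Ideal.span (pathGens K L T)) :
    g ∈ Ideal.span (pathGens K L T) := by
  classical
  obtain ⟨u, v⟩ := e
  obtain ⟨-, huv, hL⟩ := h
  simp only at huv hL
  have hg' : (X (Sum.inl u) * X (Sum.inr v) + -(X (Sum.inl v) * X (Sum.inr u))) * g ∈
      Ideal.span (pathGens K L T) := by
    rcases edgeMinor_eq_or (K := K) (u, v) with h | h
    · rwa [h, minor, sub_eq_add_neg] at hg
    · rw [h, minor, neg_mul] at hg
      rw [← sub_eq_add_neg]
      exact neg_mem_iff.1 hg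
  let w : Fin n ⊕ Fin n → ℕ := Pi.single (Sum.inr v) 1
  have hX : ∀ z : Fin n ⊕ Fin n, z ≠ Sum.inr v →
      IsWeightedHomogeneous w (X z : MvPolynomial _ K) 0 := by
    intro z hz
    have := isWeightedHomogeneous_X K w z
    rwa [show w z = 0 from Pi.single_eq_of_ne hz _] at this
  have hXv : IsWeightedHomogeneous w (X (Sum.inr v) : MvPolynomial _ K) 1 := by
    have := isWeightedHomogeneous_X K w (Sum.inr v)
    rwa [show w (Sum.inr v) = 1 from Pi.single_eq_same _ _] at this
  refine mem_of_add_mul_mem (w := w) (fun t ht => ⟨0, ?_⟩) ?_ ?_ ?_ hg'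
  · rcases ht with ⟨⟨a, b⟩, hab, rfl⟩ | ⟨z, hz, rfl⟩
    · obtain ⟨h1, h2, -⟩ := hL _ hab
      have hm : IsWeightedHomogeneous w (minor K a b) 0 :=
        ((hX (Sum.inl a) (by simp)).mul (hX (Sum.inr b) (by simpa using h2))).sub
          ((hX (Sum.inl b) (by simp)).mul (hX (Sum.inr a) (by simpa using h1)))
      rcases edgeMinor_eq_or (K := K) (a, b) with h | h
      · rw [h]
        exact hm
      · rw [h]
        exact hm.neg
    · exact hX z (hT hz _ List.mem_cons_self).2
  · simpa using (hX (Sum.inl u) (by simp)).mul hXv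
  · exact ((hX (Sum.inl v) (by simp)).mul (hX (Sum.inr u) (by simpa using huv))).neg
  · intro g hg
    rw [mul_assoc] at hg
    refine ih T (hT.trans (freeVars_cons_subset _ _)) (Sum.inr v) ?_ ?_ g
      (ih T (hT.trans (freeVars_cons_subset _ _)) (Sum.inl u) ?_ ?_ _ hg)
    · exact fun e he => ⟨by simp, by simpa using (hL e he).2.1.symm⟩
    · exact fun h => (hT h _ List.mem_cons_self).2 rfl
    · exact fun e he => ⟨by simpa using (hL e he).2.2.symm, by simp⟩
    · exact fun h => (hT h _ List.mem_cons_self).1 rfl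

/-- Let `f` be the new minor. If `X_z g = a f + y`, then `a f` lies in the ideal with `z` added to
`T`, hence so does `a`; write `a = b X_z + y'`. Now `X_z (g - b f)` lies in the ideal without `f`,
where `X_z` cancels. Enlarging `T` in this way is why the induction runs over all `T`; its base is a
monomial ideal. -/
lemma X_mul_mem_of_isPathOrdered {L : List (Fin n × Fin n)} (hL : IsPathOrdered L) :
    ∀ T ⊆ freeVars L, ∀ z ∈ freeVars L, z ∉ T → ∀ g : MvPolynomial (Fin n ⊕ Fin n) K,
      X z * g ∈ Ideal.span (pathGens K L T) → g ∈ Ideal.span (pathGens K L T) := by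
  induction L with
  | nil =>
    intro T _ z _ hzT g hg
    have h0 : pathGens K ([] : List (Fin n × Fin n)) T = X '' T := by simp [pathGens]
    rw [h0] at hg ⊢
    rw [mem_ideal_span_X_image] at hg ⊢
    intro m hm
    obtain ⟨i, hi, hmi⟩ := hg (Finsupp.single z 1 + m) (by
      rw [mem_support_iff, coeff_X_mul]
      exact mem_support_iff.1 hm)
    have hne : z ≠ i := fun h => hzT (h ▸ hi)
    exact ⟨i, hi, by simpa [Finsupp.single_apply, hne] using hmi⟩
  | cons e L ih =>
    intro T hT z hz hzT g hg
    have ih' := ih hL.1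
    have hins : ∀ x, ∀ f : MvPolynomial (Fin n ⊕ Fin n) K, ∀ s,
        x ∈ Ideal.span (insert f s) ↔ ∃ a, ∃ y ∈ Ideal.span s, x = a * f + y := by
      intro x f s
      exact Ideal.mem_span_insert
    have hcons : pathGens K (e :: L) T = insert (edgeMinor K e) (pathGens K L T) := by
      ext f
      simp only [pathGens, Set.mem_union, Set.mem_image, Set.mem_ofPred_eq, List.mem_cons,
        Set.mem_insert_iff]
      constructor
      · rintro (⟨e', rfl | h, rfl⟩ | h)
        · exact Or.inl rfl
        · exact Or.inr (Or.inl ⟨e', h, rfl⟩)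
        · exact Or.inr (Or.inr h)
      · rintro (rfl | ⟨e', h, rfl⟩ | h)
        · exact Or.inl ⟨e, Or.inl rfl, rfl⟩
        · exact Or.inl ⟨e', Or.inr h, rfl⟩
        · exact Or.inr h
    have hinsT : pathGens K L (insert z T) = insert (X z) (pathGens K L T) := by
      rw [pathGens, Set.image_insert_eq, Set.union_insert]
      rfl
    rw [hcons, hins] at hg ⊢
    obtain ⟨a, y, hy, hgy⟩ := hg
    have ha : edgeMinor K e * a ∈ Ideal.span (pathGens K L (insert z T)) := by
      rw [hinsT, hins]
      exact ⟨g, -y, neg_mem hy, by linear_combination -hgy⟩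
    have ha' := edgeMinor_mul_mem hL (Set.insert_subset hz hT) ih' ha
    rw [hinsT, hins] at ha'
    obtain ⟨b, y', hy', hay⟩ := ha'
    refine ⟨b, g - b * edgeMinor K e, ?_, by ring⟩
    refine ih' T (hT.trans (freeVars_cons_subset _ _)) z (freeVars_cons_subset _ _ hz) hzT _ ?_
    have : X z * (g - b * edgeMinor K e) = y' * edgeMinor K e + y := by
      rw [mul_sub, hgy, hay]
      ring
    rw [this]
    exact Ideal.add_mem _ (Ideal.mul_mem_right _ _ hy') hy

lemma ofList_reverse_map_edgeMinor (L : List (Fin n × Fin n)) :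
    Ideal.ofList (L.map (edgeMinor K)).reverse = Ideal.span (pathGens K L ∅) := by
  simp only [Ideal.ofList, pathGens, Set.image_empty, Set.union_empty, List.mem_reverse]
  congr 1
  ext f
  simp

/-- The minors of a path ordered list of edges form a regular sequence. -/
lemma isRegular_of_isPathOrdered {L : List (Fin n × Fin n)} (hL : IsPathOrdered L) :
    RingTheory.Sequence.IsRegular (MvPolynomial (Fin n ⊕ Fin n) K)
      (L.map (edgeMinor K)).reverse := by
  refine ⟨?_, ?_⟩
  · induction L with
    | nil => simp
    | cons e L ih =>
      rw [List.map_cons, List.reverse_cons, RingTheory.Sequence.isWeaklyRegular_append_iff,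
        RingTheory.Sequence.isWeaklyRegular_singleton_iff,
        isSMulRegular_quotient_iff_mem_of_smul_mem]
      refine ⟨ih hL.1, fun g hg => ?_⟩
      simp only [smul_eq_mul, Ideal.mul_top, ofList_reverse_map_edgeMinor] at hg ⊢
      exact edgeMinor_mul_mem hL (Set.empty_subset _) (X_mul_mem_of_isPathOrdered hL.1) hg
  · rw [smul_eq_mul, Ideal.mul_top, ofList_reverse_map_edgeMinor]
    intro h
    have hle : Ideal.span (pathGens K L ∅) ≤ RingHom.ker constantCoeff := by
      rw [Ideal.span_le]
      rintro f (⟨e, -, rfl⟩ | ⟨z, hz, -⟩)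
      · rcases edgeMinor_eq_or (K := K) e with h | h <;> simp [h, constantCoeff_minor]
      · exact absurd hz (Set.notMem_empty z)
    have := hle (h ▸ Submodule.mem_top (x := 1))
    simp at this

end Regular

/-- The length of a weakly regular sequence is a lower bound for the height. -/
lemma length_le_height_of_isWeaklyRegular {R : Type*} [CommRing R] (rs : List R)
    (h : RingTheory.Sequence.IsWeaklyRegular R rs) (Q : Ideal R) [Q.IsPrime]
    (hQ : ∀ r ∈ rs, r ∈ Q) : (rs.length : ℕ∞) ≤ Q.height := by
  induction rs using List.reverseRecOn generalizing Q with
  | nil => simp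
  | append_singleton rs r ih =>
    rw [RingTheory.Sequence.isWeaklyRegular_append_iff,
        RingTheory.Sequence.isWeaklyRegular_singleton_iff,
        isSMulRegular_quotient_iff_mem_of_smul_mem] at h
    simp only [smul_eq_mul, Ideal.mul_top] at h
    have hle : Ideal.ofList rs ≤ Q := Ideal.span_le.2 fun x hx => hQ x (by
      have : x ∈ rs := hx
      simp [this])
    -- Elements of a minimal prime over an ideal are zerodivisors modulo it, so `r` is outside `P`
    -- and each step raises the height.
    obtain ⟨P, hP, hPQ⟩ := Ideal.exists_minimalPrimes_le hle
    have := hP.1.1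
    have hr : r ∉ P := by
      intro hr
      obtain ⟨y, hy, hry⟩ := Ideal.exists_mul_mem_of_mem_minimalPrimes hP hr
      exact hy (h.2 y hry)
    have hlt : P < Q := lt_of_le_of_ne hPQ fun h => hr (h ▸ hQ r (by simp))
    have := ih h.1 P fun x hx => hP.1.2 (Ideal.subset_span hx)
    rw [List.length_append, List.length_singleton]
    push_cast
    exact (add_le_add_left this 1).trans (Ideal.height_add_one_le_of_lt_of_isPrime hlt)

/-! ### Binomials in minimal generating sets -/

section MinimalGenerators

open MvPolynomial

variable {n : ℕ}

/-- The exponent of the monomial `X_i Y_j`. -/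
noncomputable def minorExp (i j : Fin n) : Fin n ⊕ Fin n →₀ ℕ :=
  Finsupp.single (Sum.inl i) 1 + Finsupp.single (Sum.inr j) 1

lemma minorExp_inj {i j k l : Fin n} : minorExp i j = minorExp k l ↔ i = k ∧ j = l := by
  constructor
  · intro h
    have h1 := DFunLike.congr_fun h (Sum.inl i)
    have h2 := DFunLike.congr_fun h (Sum.inr j)
    simp only [minorExp, Finsupp.add_apply, Finsupp.single_apply] at h1 h2
    constructor
    · by_contra hne
      simp [Ne.symm hne] at h1
    · by_contra hne
      simp [Ne.symm hne] at h2
  · rintro ⟨rfl, rfl⟩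
    rfl

variable {K : Type u} [Field K]

lemma minor_eq_monomial (i j : Fin n) :
    minor K i j = monomial (minorExp i j) 1 - monomial (minorExp j i) 1 := by
  simp [minor, minorExp, X, monomial_mul]

open Classical in
lemma coeff_minor (i j : Fin n) (m : Fin n ⊕ Fin n →₀ ℕ) :
    coeff m (minor K i j) =
      (if minorExp i j = m then 1 else 0) - (if minorExp j i = m then 1 else 0) := by
  rw [minor_eq_monomial, coeff_sub, coeff_monomial, coeff_monomial]

lemma isHomogeneous_minor (i j : Fin n) : (minor K i j).IsHomogeneous 2 :=
  ((isHomogeneous_X K _).mul (isHomogeneous_X K _)).sub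
    ((isHomogeneous_X K _).mul (isHomogeneous_X K _))

/-- In the lowest possible degree only scalar multiples of generators contribute. This turns
questions on ideal membership in degree two into linear algebra over `K`. -/
lemma homogeneousComponent_two_mem_span {σ : Type} {T : Set (MvPolynomial σ K)}
    (hT : ∀ t ∈ T, ∃ d, 2 ≤ d ∧ t.IsHomogeneous d) {g : MvPolynomial σ K}
    (hg : g ∈ Ideal.span T) :
    homogeneousComponent 0 g = 0 ∧ homogeneousComponent 1 g = 0 ∧
      homogeneousComponent 2 g ∈ Submodule.span K {t ∈ T | t.IsHomogeneous 2} := by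
  induction hg using Submodule.span_induction with
  | mem t ht =>
    obtain ⟨d, hd, htd⟩ := hT t ht
    have h := fun k => homogeneousComponent_of_mem (m := k) (mem_homogeneousSubmodule d t |>.2 htd)
    rw [h, h, h, if_neg (by omega), if_neg (by omega)]
    refine ⟨rfl, rfl, ?_⟩
    split_ifs with h2
    · exact Submodule.subset_span ⟨ht, h2 ▸ htd⟩
    · exact Submodule.zero_mem _
  | zero => simp
  | add p q _ _ hp hq =>
    simp only [map_add, hp.1, hp.2.1, hq.1, hq.2.1, add_zero, true_and]
    exact Submodule.add_mem _ hp.2.2 hq.2.2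
  | smul a p _ hp =>
    induction a using MvPolynomial.induction_on' with
    | monomial u r =>
      have h := fun k => weightedHomogeneousComponent_mul_left
        (isWeightedHomogeneous_monomial (R := K) 1 u r rfl) p k
      simp only [smul_eq_mul]
      simp only [homogeneousComponent] at hp ⊢
      rw [h, h, h]
      obtain ⟨hp0, hp1, hp2⟩ := hp
      rcases Nat.eq_zero_or_pos (Finsupp.weight 1 u) with h0 | h0
      · have hu : u = 0 := by
          have : u.degree = 0 := by rw [Finsupp.degree_eq_weight_one]; exact h0
          exact (Finsupp.degree_eq_zero_iff u).1 this
        rw [h0]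
        simp only [zero_le, if_true, Nat.sub_zero, hp0, hp1, mul_zero, true_and]
        rw [hu, ← C_apply, ← smul_eq_C_mul]
        exact Submodule.smul_mem _ _ hp2
      · refine ⟨?_, ?_, ?_⟩
        · rw [if_neg (by omega)]
        · split_ifs with h1
          · rw [show 1 - Finsupp.weight 1 u = 0 by omega, hp0, mul_zero]
          · rfl
        · split_ifs with h1
          · obtain h2 | h2 : 2 - Finsupp.weight 1 u = 0 ∨ 2 - Finsupp.weight 1 u = 1 := by omega
            · rw [h2, hp0, mul_zero]
              exact Submodule.zero_mem _
            · rw [h2, hp1, mul_zero]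
              exact Submodule.zero_mem _
          · exact Submodule.zero_mem _
    | add a b ha hb =>
      simp only [add_smul, map_add, ha.1, ha.2.1, hb.1, hb.2.1, add_zero, true_and]
      exact Submodule.add_mem _ ha.2.2 hb.2.2

variable (G : SimpleGraph (Fin n))

variable (K) in
/-- The standard generators of the binomial edge ideal. -/
def edgeGens : Set (MvPolynomial (Fin n ⊕ Fin n) K) :=
  {f | ∃ i j : Fin n, i < j ∧ G.Adj i j ∧ f = minor K i j}

lemma span_edgeGens : Ideal.span (edgeGens K G) = binomialEdgeIdeal K G := rfl

variable {G}

lemma isHomogeneous_of_mem_edgeGens {t : MvPolynomial (Fin n ⊕ Fin n) K}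
    (ht : t ∈ edgeGens K G) : t.IsHomogeneous 2 := by
  obtain ⟨i, j, -, -, rfl⟩ := ht
  exact isHomogeneous_minor i j

/-- The standard generators of the binomial edge ideal form a minimal generating set. -/
lemma isMinimalGeneratingSet_edgeGens :
    IsMinimalGeneratingSet (binomialEdgeIdeal K G) (edgeGens K G) := by
  refine ⟨⟨fun f hf => ⟨2, isHomogeneous_of_mem_edgeGens hf⟩, span_edgeGens G⟩, ?_⟩
  rintro T ⟨-, hT⟩ hTS f hf
  obtain ⟨i, j, hij, hadj, rfl⟩ := hf
  by_contra hfT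
  have hmem : minor K i j ∈ Ideal.span T := by
    rw [hT]
    exact minor_mem_binomialEdgeIdeal G K hadj
  have h2 := (homogeneousComponent_two_mem_span
    (fun t ht => ⟨2, le_rfl, isHomogeneous_of_mem_edgeGens (hTS ht)⟩) hmem).2.2
  rw [homogeneousComponent_of_mem (mem_homogeneousSubmodule 2 _ |>.2 (isHomogeneous_minor i j)),
    if_pos rfl] at h2
  -- The monomial `X_i Y_j` occurs in no other standard generator.
  have hzero : ∀ g ∈ Submodule.span K {t ∈ T | t.IsHomogeneous 2},
      coeff (minorExp i j) g = 0 := by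
    intro g hg
    induction hg using Submodule.span_induction with
    | mem t ht =>
      obtain ⟨k, l, hkl, -, rfl⟩ := hTS ht.1
      have h1 : ¬ (k = i ∧ l = j) := by
        rintro ⟨rfl, rfl⟩
        exact hfT ht.1
      have h2 : ¬ (l = i ∧ k = j) := by
        rintro ⟨rfl, rfl⟩
        exact absurd hij (not_lt.2 hkl.le)
      simp [coeff_minor, minorExp_inj, h1, h2]
    | zero => simp
    | add p q _ _ hp hq => simp [hp, hq]
    | smul a p _ hp => simp [hp]
  have := hzero _ h2
  have hne : ¬ (j = i ∧ i = j) := fun h => hij.ne h.2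
  simp [coeff_minor, minorExp_inj, hne] at this

/-- The degree-two part of `S` already generates the ideal, which is generated in degree two, so
minimality rules out everything else. -/
lemma isHomogeneous_two_of_mem {S : Set (MvPolynomial (Fin n ⊕ Fin n) K)}
    (hS : IsMinimalGeneratingSet (binomialEdgeIdeal K G) S) {f : MvPolynomial (Fin n ⊕ Fin n) K}
    (hf : f ∈ S) : f.IsHomogeneous 2 := by
  obtain ⟨⟨hhom, hspan⟩, hmin⟩ := hS
  have hge : ∀ f ∈ S, ∃ d, 2 ≤ d ∧ f.IsHomogeneous d := by
    intro f hf
    obtain ⟨d, hd⟩ := hhom f hf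
    have hfJ : f ∈ Ideal.span (edgeGens K G) := by
      rw [span_edgeGens, ← hspan]
      exact Ideal.subset_span hf
    obtain ⟨h0, h1, -⟩ := homogeneousComponent_two_mem_span
      (fun t ht => ⟨2, le_rfl, isHomogeneous_of_mem_edgeGens ht⟩) hfJ
    by_cases h2 : 2 ≤ d
    · exact ⟨d, h2, hd⟩
    · have hself : homogeneousComponent d f = f := by
        rw [homogeneousComponent_of_mem (mem_homogeneousSubmodule d _ |>.2 hd), if_pos rfl]
      have hf0 : f = 0 := by
        obtain rfl | rfl : d = 0 ∨ d = 1 := by omega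
        · exact hself.symm.trans h0
        · exact hself.symm.trans h1
      -- A generator of degree below two is zero, and zero may be assigned degree two.
      exact ⟨2, le_rfl, hf0 ▸ isHomogeneous_zero _ _ _⟩
  have hS2 : Ideal.span {t ∈ S | t.IsHomogeneous 2} = binomialEdgeIdeal K G := by
    refine le_antisymm ?_ ?_
    · rw [← hspan]
      exact Ideal.span_mono fun t ht => ht.1
    · rw [binomialEdgeIdeal_le_iff]
      intro i j hij
      have hmem : minor K i j ∈ Ideal.span S := by
        rw [hspan]
        exact minor_mem_binomialEdgeIdeal G K hij
      have h2 := (homogeneousComponent_two_mem_span hge hmem).2.2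
      rw [homogeneousComponent_of_mem (mem_homogeneousSubmodule 2 _ |>.2 (isHomogeneous_minor i j)),
        if_pos rfl] at h2
      exact Submodule.span_le_restrictScalars K _ _ h2
  exact (hmin ⟨fun t ht => ⟨2, ht.2⟩, hS2⟩ (fun t ht => ht.1) hf).2

/-- The binomials of degree two in the binomial edge ideal are the multiples of the standard
generators. -/
lemma exists_eq_smul_minor {f : MvPolynomial (Fin n ⊕ Fin n) K} (hf : f ∈ binomialEdgeIdeal K G)
    (hf2 : f.IsHomogeneous 2) (hcard : f.support.card = 2) :
    ∃ i j, G.Adj i j ∧ ∃ a : K, f = a • minor K i j := by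
  classical
  have h2 := (homogeneousComponent_two_mem_span
      (fun t ht => ⟨2, le_rfl, isHomogeneous_of_mem_edgeGens ht⟩)
      (show f ∈ Ideal.span (edgeGens K G) from hf)).2.2
  rw [homogeneousComponent_of_mem (mem_homogeneousSubmodule 2 _ |>.2 hf2), if_pos rfl] at h2
  -- Both properties are linear and hold for minors: only edge monomials occur, and swapping the
  -- indices changes the sign. Two terms must then be each other's swap.
  have hspan : (∀ m, coeff m f ≠ 0 → ∃ i j, G.Adj i j ∧ m = minorExp i j) ∧
      ∀ i j, coeff (minorExp j i) f = -coeff (minorExp i j) f := by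
    clear hf hf2 hcard
    induction h2 using Submodule.span_induction with
    | mem t ht =>
      obtain ⟨⟨i, j, -, hij, rfl⟩, -⟩ := ht
      refine ⟨fun m hm => ?_, fun k l => ?_⟩
      · rw [coeff_minor] at hm
        by_cases h1 : minorExp i j = m
        · exact ⟨i, j, hij, h1.symm⟩
        by_cases h2 : minorExp j i = m
        · exact ⟨j, i, hij.symm, h2.symm⟩
        simp [h1, h2] at hm
      · simp only [coeff_minor, minorExp_inj, and_comm, neg_sub]
    | zero => simp
    | add p q _ _ hp hq =>
      refine ⟨fun m hm => ?_, fun i j => by rw [coeff_add, coeff_add, hp.2, hq.2]; ring⟩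
      by_cases h : coeff m p = 0
      · exact hq.1 m (by rwa [coeff_add, h, zero_add] at hm)
      · exact hp.1 m h
    | smul a p _ hp =>
      refine ⟨fun m hm => hp.1 m ?_, fun i j => by simp [hp.2 i j]⟩
      rw [coeff_smul] at hm
      exact right_ne_zero_of_mul hm
  obtain ⟨m, hm⟩ : f.support.Nonempty := Finset.card_pos.1 (by omega)
  obtain ⟨i, j, hij, rfl⟩ := hspan.1 m (mem_support_iff.1 hm)
  have hne : minorExp i j ≠ minorExp j i := fun h => hij.ne (minorExp_inj.1 h).1
  have hm' : minorExp j i ∈ f.support := by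
    rw [mem_support_iff, hspan.2, neg_ne_zero]
    exact mem_support_iff.1 hm
  have hsupp : f.support = {minorExp i j, minorExp j i} := by
    refine (Finset.eq_of_subset_of_card_le ?_ ?_).symm
    · intro x hx
      rw [Finset.mem_insert, Finset.mem_singleton] at hx
      rcases hx with rfl | rfl <;> assumption
    · rw [hcard, Finset.card_pair hne]
  refine ⟨i, j, hij, coeff (minorExp i j) f, ?_⟩
  ext m
  rw [coeff_smul, coeff_minor]
  by_cases h1 : minorExp i j = m
  · subst h1
    simp [hne.symm]
  by_cases h2 : minorExp j i = m
  · subst h2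
    simp [hne, hspan.2 i j]
  · have : m ∉ f.support := by
      rw [hsupp]
      simp [Ne.symm h1, Ne.symm h2]
    simp [h1, h2, notMem_support_iff.1 this]

lemma sum_card_sub_one_image_le {A : Finset (Sym2 (Fin n))} (hA : ∀ e ∈ A, ¬ e.IsDiag) :
    ∑ U ∈ A.image Sym2.toFinset, (U.card - 1) ≤ A.card := by
  classical
  refine le_trans (Finset.sum_le_card_nsmul _ _ 1 ?_) ?_
  · intro U hU
    obtain ⟨e, he, rfl⟩ := Finset.mem_image.1 hU
    rw [Sym2.card_toFinset_of_not_isDiag e (hA e he)]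
  · simpa using Finset.card_image_le

/-- A regular sequence of binomials in a minimal generating set yields a feasible point of the
integer path packing program. -/
lemma binomialRegularLengths_subset {k : ℕ}
    (hk : k ∈ binomialRegularLengths (binomialEdgeIdeal K G)) : (k : ℤ) ∈ ppValues G ℤ := by
  classical
  obtain ⟨S, rs, hS, hrs, hreg, rfl⟩ := hk
  have hedge : ∀ f ∈ rs, ∃ e : G.edgeSet, ∀ P : Ideal (MvPolynomial (Fin n ⊕ Fin n) K),
      (∀ i j, e.1 = s(i, j) → minor K i j ∈ P) → f ∈ P := by
    intro f hf
    have hfJ : f ∈ binomialEdgeIdeal K G := by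
      rw [← hS.1.2]
      exact Ideal.subset_span (hrs f hf).1
    obtain ⟨i, j, hij, a, rfl⟩ := exists_eq_smul_minor hfJ
      (isHomogeneous_two_of_mem hS (hrs f hf).1) (hrs f hf).2
    refine ⟨⟨s(i, j), hij⟩, fun P hP => ?_⟩
    rw [smul_eq_C_mul]
    exact P.mul_mem_left _ (hP i j rfl)
  choose e he using hedge
  let F : Finset G.edgeSet := (rs.attach.map fun f => e f.1 f.2).toFinset
  have hFcard : F.card ≤ rs.length := by
    simpa using List.toFinset_card_le (rs.attach.map fun f => e f.1 f.2)
  have hFmem : ∀ f (hf : f ∈ rs), e f hf ∈ F := by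
    intro f hf
    rw [List.mem_toFinset, List.mem_map]
    exact ⟨⟨f, hf⟩, List.mem_attach _ _, rfl⟩
  -- Weak duality: a cover of the edges in `F` gives a prime containing the sequence, whose height
  -- bounds the length.
  have hbound : ∀ (V : Finset (Fin n)) (𝒰 : Finset (Finset (Fin n))), (∀ U ∈ 𝒰, U.Nonempty) →
      (∀ e ∈ F, (∃ v ∈ V, v ∈ e.1) ∨ ∃ U ∈ 𝒰, ∀ v ∈ e.1, v ∈ U) →
      rs.length ≤ 2 * V.card + ∑ U ∈ 𝒰, (U.card - 1) := by
    intro V 𝒰 h𝒰 hcov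
    obtain ⟨P, hP, hPh, hPV, hPU, -⟩ := exists_isPrime_height_le K V 𝒰 h𝒰
    have := length_le_height_of_isWeaklyRegular rs hreg.toIsWeaklyRegular P (by
      intro f hf
      refine he f hf P fun i j hij => ?_
      rcases hcov _ (hFmem f hf) with ⟨v, hv, hve⟩ | ⟨U, hU, heU⟩
      · rw [hij, Sym2.mem_iff] at hve
        rcases hve with rfl | rfl
        · exact P.sub_mem (P.mul_mem_right _ ((hPV v).1.2 hv)) (P.mul_mem_left _ ((hPV v).2.2 hv))
        · exact P.sub_mem (P.mul_mem_left _ ((hPV v).2.2 hv)) (P.mul_mem_right _ ((hPV v).1.2 hv))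
      · exact hPU U hU i (heU i (by simp [hij])) j (heU j (by simp [hij])))
    exact_mod_cast this.trans hPh
  have hdiag : ∀ A : Finset G.edgeSet, ∀ e ∈ A.image Subtype.val, ¬ e.IsDiag := by
    intro A e he
    obtain ⟨e, -, rfl⟩ := Finset.mem_image.1 he
    exact G.not_isDiag_of_mem_edgeSet e.2
  have hne : ∀ A : Finset G.edgeSet, ∀ U ∈ (A.image Subtype.val).image Sym2.toFinset,
      U.Nonempty := by
    intro A U hU
    obtain ⟨e, he, rfl⟩ := Finset.mem_image.1 hU
    rw [← Finset.card_pos, Sym2.card_toFinset_of_not_isDiag e (hdiag A e he)]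
    norm_num
  have hsum : ∀ A : Finset G.edgeSet,
      ∑ U ∈ (A.image Subtype.val).image Sym2.toFinset, (U.card - 1) ≤ A.card := fun A =>
    (sum_card_sub_one_image_le (hdiag A)).trans Finset.card_image_le
  have hcovA : ∀ A : Finset G.edgeSet, ∀ e ∈ A,
      ∃ U ∈ (A.image Subtype.val).image Sym2.toFinset, ∀ v ∈ e.1, v ∈ U := by
    intro A e he
    exact ⟨_, Finset.mem_image_of_mem _ (Finset.mem_image_of_mem _ he), fun v hv => by simpa⟩
  -- Covering each edge by its own two-element set shows that different members of the sequence have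
  -- different edges.
  have hFlen : rs.length = F.card := by
    refine le_antisymm ?_ hFcard
    have := hbound ∅ _ (hne F) fun e he => Or.inr (hcovA F e he)
    have h2 := hsum F
    simp only [Finset.card_empty, mul_zero, zero_add] at this
    exact this.trans h2
  have hval : ∀ p : G.edgeSet → Prop, ∑ e ∈ (Finset.univ : Finset G.edgeSet) with p e,
      (if e ∈ F then (1 : ℤ) else 0) = (F.filter p).card := by
    intro p
    rw [← Finset.sum_filter, Finset.filter_filter, Finset.sum_const, nsmul_eq_mul, mul_one]
    congr 2
    ext e
    simp [and_comm]
  refine ⟨fun e => if e ∈ F then 1 else 0, ⟨fun e => by split_ifs <;> norm_num, fun U hU => ?_,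
    fun v => ?_⟩, ?_⟩
  · obtain ⟨p, hp⟩ : ∃ p : G.edgeSet → Prop, p = fun e => ∀ v ∈ e.1, v ∈ U := ⟨_, rfl⟩
    have h := hval p
    refine le_trans (b := ((F.filter p).card : ℤ)) (Eq.le (by subst hp; convert h)) ?_
    let A := F.filter fun e => ¬ p e
    have hA := Finset.card_filter_add_card_filter_not (s := F) p
    -- Covering the edges inside `U` by `U` and every other edge by itself leaves at most `|U| - 1`
    -- edges inside.
    have hb := hbound ∅ (insert U ((A.image Subtype.val).image Sym2.toFinset)) (by
      intro U' hU'
      rcases Finset.mem_insert.1 hU' with rfl | hU'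
      · exact Finset.card_pos.1 (by omega)
      · exact hne A U' hU') (by
      intro e he
      by_cases heU : p e
      · exact Or.inr ⟨U, Finset.mem_insert_self _ _, by subst hp; exact heU⟩
      · obtain ⟨U', hU', h'⟩ := hcovA A e (Finset.mem_filter.2 ⟨he, heU⟩)
        exact Or.inr ⟨U', Finset.mem_insert_of_mem hU', h'⟩)
    have h3 : ∑ U' ∈ insert U ((A.image Subtype.val).image Sym2.toFinset), (U'.card - 1) ≤
        (U.card - 1) + A.card := by
      refine le_trans ?_ (add_le_add_right (hsum A) _)
      by_cases hmem : U ∈ (A.image Subtype.val).image Sym2.toFinset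
      · rw [Finset.insert_eq_of_mem hmem]
        omega
      · rw [Finset.sum_insert hmem]
    simp only [Finset.card_empty, mul_zero, zero_add] at hb
    have h4 := hb.trans h3
    simp only [A] at h4
    omega
  · obtain ⟨p, hp⟩ : ∃ p : G.edgeSet → Prop, p = fun e => v ∈ e.1 := ⟨_, rfl⟩
    have h := hval p
    refine le_trans (b := ((F.filter p).card : ℤ)) (Eq.le (by subst hp; convert h)) ?_
    let A := F.filter fun e => ¬ p e
    have hA := Finset.card_filter_add_card_filter_not (s := F) p
    -- The same comparison with the edges at `v` covered by `v`, at cost two.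
    have hb := hbound {v} _ (hne A) (by
      intro e he
      by_cases hev : p e
      · exact Or.inl ⟨v, Finset.mem_singleton_self v, by subst hp; exact hev⟩
      · exact Or.inr (hcovA A e (Finset.mem_filter.2 ⟨he, hev⟩)))
    have h3 := hsum A
    have h4 := hb.trans (add_le_add_right h3 _)
    simp only [A, Finset.card_singleton, mul_one] at h4
    omega
  · rw [hFlen]
    have h := hval fun _ => True
    simp only [Finset.filter_true] at h
    rw [← h]

end MinimalGenerators

/-! ### Semi-paths -/

section SemiPaths

variable {n : ℕ} {G : SimpleGraph (Fin n)}

/-- A semi-path carries a ranking of its vertices by the position on their paths. -/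
lemma IsSemiPath.exists_rank {P : G.Subgraph} (hP : IsSemiPath P) :
    ∃ ρ : Fin n → ℕ, (∀ u v, P.Adj u v → ρ v = ρ u + 1 ∨ ρ u = ρ v + 1) ∧
      ∀ u v v', P.Adj u v → P.Adj u v' → ρ v = ρ v' → v = v' := by
  classical
  choose a b w hw hsub using hP
  have hpos : ∀ x : P.verts, ∃ i, ∀ c, P.coe.connectedComponentMk x = c →
      i ≤ (w c).length ∧ (w c).getVert i = x := by
    intro x
    have hx : x ∈ (w (P.coe.connectedComponentMk x)).support := by
      rw [← SimpleGraph.Walk.mem_verts_toSubgraph, hsub]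
      exact SimpleGraph.ConnectedComponent.connectedComponentMk_mem
    obtain ⟨i, hi, hil⟩ := SimpleGraph.Walk.mem_support_iff_exists_getVert.1 hx
    refine ⟨i, ?_⟩
    rintro c rfl
    exact ⟨hil, hi⟩
  choose pos hpos using hpos
  have hinj : ∀ x y, P.coe.connectedComponentMk x = P.coe.connectedComponentMk y →
      pos x = pos y → x = y := by
    intro x y hc hxy
    rw [← (hpos x _ rfl).2, ← (hpos y _ hc.symm).2, hxy]
  have hadj : ∀ x y, P.coe.Adj x y → pos y = pos x + 1 ∨ pos x = pos y + 1 := by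
    intro x y hxy
    have hc : P.coe.connectedComponentMk x = P.coe.connectedComponentMk y :=
      SimpleGraph.ConnectedComponent.sound hxy.reachable
    obtain ⟨hx1, hx2⟩ := hpos x _ rfl
    obtain ⟨hy1, hy2⟩ := hpos y _ hc.symm
    have hw' := hw (P.coe.connectedComponentMk x)
    have hadj : (w (P.coe.connectedComponentMk x)).toSubgraph.Adj x y := by
      rw [hsub, SimpleGraph.Subgraph.induce_adj]
      exact ⟨SimpleGraph.ConnectedComponent.connectedComponentMk_mem, hc.symm, hxy⟩
    obtain ⟨i, hi, hil⟩ := (SimpleGraph.Walk.toSubgraph_adj_iff _).1 hadj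
    rw [Sym2.eq_iff] at hi
    rcases hi with ⟨h1, h2⟩ | ⟨h1, h2⟩
    · have e1 := hw'.getVert_injOn hil.le hx1 (h1.trans hx2.symm)
      have e2 := hw'.getVert_injOn (Nat.succ_le_of_lt hil) hy1 (h2.trans hy2.symm)
      omega
    · have e1 := hw'.getVert_injOn hil.le hy1 (h1.trans hy2.symm)
      have e2 := hw'.getVert_injOn (Nat.succ_le_of_lt hil) hx1 (h2.trans hx2.symm)
      omega
  have hρ : ∀ v (h : v ∈ P.verts), (if h : v ∈ P.verts then pos ⟨v, h⟩ else 0) = pos ⟨v, h⟩ :=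
    fun v h => dif_pos h
  -- The rank is the index on the path tracing the component; the default `0` outside `P` is never
  -- tested.
  refine ⟨fun v => if h : v ∈ P.verts then pos ⟨v, h⟩ else 0, fun u v huv => ?_,
    fun u v v' h1 h2 h => ?_⟩
  · simp only [hρ _ huv.fst_mem, hρ _ huv.snd_mem]
    exact hadj ⟨u, huv.fst_mem⟩ ⟨v, huv.snd_mem⟩ huv
  · simp only [hρ _ h1.snd_mem, hρ _ h2.snd_mem] at h
    have e1 : P.coe.Adj ⟨u, h1.fst_mem⟩ ⟨v, h1.snd_mem⟩ := h1
    have e2 : P.coe.Adj ⟨u, h1.fst_mem⟩ ⟨v', h2.snd_mem⟩ := h2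
    have := hinj _ _ (SimpleGraph.ConnectedComponent.sound
      (e1.symm.reachable.trans e2.reachable)) h
    exact congrArg Subtype.val this

/-- Edges are added by increasing rank of their heads. An earlier edge starting at the new head
would have a head of even larger rank, and common tails or heads are excluded by `h2` and `h3`. -/
lemma exists_isPathOrdered_list (ρ : Fin n → ℕ) (D : Finset (Fin n × Fin n))
    (h1 : ∀ e ∈ D, ρ e.2 = ρ e.1 + 1) (h2 : ∀ e ∈ D, ∀ e' ∈ D, e.1 = e'.1 → e = e')
    (h3 : ∀ e ∈ D, ∀ e' ∈ D, e.2 = e'.2 → e = e') :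
    ∃ L : List (Fin n × Fin n), IsPathOrdered L ∧ L.length = D.card ∧ ∀ e, e ∈ L ↔ e ∈ D := by
  classical
  induction D using Finset.induction_on_max_value (fun e : Fin n × Fin n => ρ e.2) with
  | empty => exact ⟨[], trivial, by simp⟩
  | insert e D he hmax ih =>
    obtain ⟨L, hL, hlen, hmem⟩ := ih (fun x hx => h1 x (Finset.mem_insert_of_mem hx))
      (fun x hx y hy => h2 x (Finset.mem_insert_of_mem hx) y (Finset.mem_insert_of_mem hy))
      (fun x hx y hy => h3 x (Finset.mem_insert_of_mem hx) y (Finset.mem_insert_of_mem hy))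
    have hself := Finset.mem_insert_self e D
    refine ⟨e :: L, ⟨hL, fun h => ?_, fun e' he' => ⟨fun h => ?_, fun h => ?_, fun h => ?_⟩⟩, ?_, ?_⟩
    · have := h1 e hself
      rw [h] at this
      omega
    · rw [hmem] at he'
      have e1 := h1 e' (Finset.mem_insert_of_mem he')
      have e2 := hmax e' he'
      simp only [h] at e1 e2
      omega
    · rw [hmem] at he'
      exact he (h3 _ (Finset.mem_insert_of_mem he') _ hself h ▸ he')
    · rw [hmem] at he'
      exact he (h2 _ (Finset.mem_insert_of_mem he') _ hself h ▸ he')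
    · rw [List.length_cons, hlen, Finset.card_insert_of_notMem he]
    · intro x
      rw [List.mem_cons, Finset.mem_insert, hmem]

lemma card_support_minor {K : Type u} [Field K] {i j : Fin n} (hij : i ≠ j) :
    (minor K i j).support.card = 2 := by
  classical
  have hne : minorExp i j ≠ minorExp j i := fun h => hij (minorExp_inj.1 h).1
  have : (minor K i j).support = {minorExp i j, minorExp j i} := by
    ext m
    rw [MvPolynomial.mem_support_iff, coeff_minor, Finset.mem_insert, Finset.mem_singleton]
    by_cases h1 : minorExp i j = m
    · subst h1
      simp [hne.symm]
    · by_cases h2 : minorExp j i = m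
      · subst h2
        simp [hne]
      · simp [h1, h2, Ne.symm h1, Ne.symm h2]
  rw [this, Finset.card_pair hne]

/-- The minors of the edges of a semi-path form a regular sequence. -/
lemma mem_binomialRegularLengths_of_mem_semiPathSizes (K : Type u) [Field K] {k : ℕ}
    (hk : k ∈ semiPathSizes G) : k ∈ binomialRegularLengths (binomialEdgeIdeal K G) := by
  classical
  obtain ⟨P, hP, rfl⟩ := hk
  obtain ⟨ρ, hρ1, hρ2⟩ := hP.exists_rank
  let D : Finset (Fin n × Fin n) := {e | P.Adj e.1 e.2 ∧ ρ e.2 = ρ e.1 + 1}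
  have hD : ∀ e, e ∈ D ↔ P.Adj e.1 e.2 ∧ ρ e.2 = ρ e.1 + 1 := fun e => by simp [D]
  have hcard : P.edgeSet.ncard = D.card := by
    have himg : P.edgeSet = ((D.image fun e => s(e.1, e.2) : Finset (Sym2 (Fin n))) :
        Set (Sym2 (Fin n))) := by
      ext e
      induction e using Sym2.ind with
      | _ u v =>
      rw [SimpleGraph.Subgraph.mem_edgeSet, Finset.mem_coe, Finset.mem_image]
      constructor
      · intro h
        rcases hρ1 u v h with h' | h'
        · exact ⟨(u, v), (hD _).2 ⟨h, h'⟩, rfl⟩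
        · exact ⟨(v, u), (hD _).2 ⟨h.symm, h'⟩, Sym2.eq_swap⟩
      · rintro ⟨⟨a, b⟩, hab, h⟩
        have hab := ((hD _).1 hab).1
        rw [← SimpleGraph.Subgraph.mem_edgeSet, ← h]
        exact hab
    rw [himg, Set.ncard_coe_finset, Finset.card_image_of_injOn]
    rintro ⟨a, b⟩ hab ⟨a', b'⟩ hab' h
    have e1 := ((hD _).1 hab).2
    have e2 := ((hD _).1 hab').2
    simp only [Sym2.eq_iff] at h e1 e2
    rcases h with ⟨rfl, rfl⟩ | ⟨rfl, rfl⟩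
    · rfl
    · omega
  obtain ⟨L, hL, hlen, hmem⟩ := exists_isPathOrdered_list ρ D (fun e he => ((hD e).1 he).2) (by
    rintro ⟨a, b⟩ hab ⟨a', b'⟩ hab' h
    obtain ⟨e1, e2⟩ := (hD _).1 hab
    obtain ⟨e3, e4⟩ := (hD _).1 hab'
    simp only at h e1 e2 e3 e4
    subst h
    rw [hρ2 a b b' e1 e3 (by omega)]) (by
    rintro ⟨a, b⟩ hab ⟨a', b'⟩ hab' h
    obtain ⟨e1, e2⟩ := (hD _).1 hab
    obtain ⟨e3, e4⟩ := (hD _).1 hab'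
    simp only at h e1 e2 e3 e4
    subst h
    rw [hρ2 b a a' e1.symm e3.symm (by omega)])
  refine ⟨edgeGens K G, _, isMinimalGeneratingSet_edgeGens, ?_,
    isRegular_of_isPathOrdered (K := K) hL, ?_⟩
  · intro f hf
    rw [List.mem_reverse, List.mem_map] at hf
    obtain ⟨⟨u, v⟩, huv, rfl⟩ := hf
    have hG : G.Adj u v := ((hD _).1 ((hmem _).1 huv)).1.adj_sub
    rw [edgeMinor]
    split_ifs with h
    · exact ⟨⟨u, v, h, hG, rfl⟩, card_support_minor hG.ne⟩
    · exact ⟨⟨v, u, lt_of_le_of_ne (not_lt.1 h) hG.ne.symm, hG.symm, rfl⟩, card_support_minor hG.ne.symm⟩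
  · rw [List.length_reverse, List.length_map, hlen, hcard]

/-- In a finite graph without vertices of degree three, and in which paths are induced, every
component is a path. -/
lemma exists_isPath_toSubgraph_eq_induce_supp {W : Type*} [Finite W] (H : SimpleGraph W)
    (hdeg : ∀ v a b c, H.Adj v a → H.Adj v b → H.Adj v c → a = b ∨ a = c ∨ b = c)
    (hpath : ∀ a b (w : H.Walk a b), w.IsPath → ∀ s ∈ w.support, ∀ t ∈ w.support,
      H.Adj s t → s(s, t) ∈ w.edges) (c : H.ConnectedComponent) :
    ∃ (a b : W) (w : H.Walk a b), w.IsPath ∧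
      w.toSubgraph = (⊤ : H.Subgraph).induce c.supp := by
  classical
  have := Fintype.ofFinite W
  let p : ℕ → Prop := fun m => ∃ a b, ∃ w : H.Walk a b,
    H.connectedComponentMk a = c ∧ w.IsPath ∧ w.length = m
  have hp0 : p 0 := by
    induction c using SimpleGraph.ConnectedComponent.ind with
    | _ v => exact ⟨v, v, .nil, rfl, .nil, rfl⟩
  -- A longest path in the component: neighbours of its ends lie on it by maximality, neighbours of
  -- its inner vertices by the degree condition, so it fills the component.
  obtain ⟨a, b, w, hac, hw, hlen⟩ : p (Nat.findGreatest p (Fintype.card W)) :=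
    Nat.findGreatest_spec (Nat.zero_le _) hp0
  have hmax : ∀ (a' b' : W) (w' : H.Walk a' b'), H.connectedComponentMk a' = c → w'.IsPath →
      w'.length ≤ w.length := by
    intro a' b' w' hc hw'
    rw [hlen]
    exact Nat.le_findGreatest hw'.length_lt.le ⟨a', b', w', hc, hw', rfl⟩
  have hend : ∀ (a b : W) (w' : H.Walk a b), H.connectedComponentMk a = c → w'.IsPath →
      w'.length = w.length → ∀ t, H.Adj a t → t ∈ w'.support := by
    intro a b w' hc hw' hl t hat
    by_contra ht
    have := hmax t b (.cons hat.symm w')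
      ((SimpleGraph.ConnectedComponent.sound hat.symm.reachable).trans hc)
      (hw'.cons ht)
    rw [SimpleGraph.Walk.length_cons] at this
    omega
  have hclosed : ∀ s ∈ w.support, ∀ t, H.Adj s t → t ∈ w.support := by
    intro s hs t hst
    obtain ⟨i, rfl, hi⟩ := SimpleGraph.Walk.mem_support_iff_exists_getVert.1 hs
    rcases Nat.eq_zero_or_pos i with rfl | hi0
    · rw [SimpleGraph.Walk.getVert_zero] at hst
      exact hend a b w hac hw rfl t hst
    rcases hi.eq_or_lt with rfl | hil
    · rw [SimpleGraph.Walk.getVert_length] at hst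
      have := hend b a w.reverse
        ((SimpleGraph.ConnectedComponent.sound w.reverse.reachable).trans hac) hw.reverse
        (SimpleGraph.Walk.length_reverse w) t hst
      rwa [SimpleGraph.Walk.support_reverse, List.mem_reverse] at this
    · obtain ⟨j, rfl⟩ : ∃ j, i = j + 1 := ⟨i - 1, by omega⟩
      have h1 := w.adj_getVert_succ (show j < w.length by omega)
      have h2 := w.adj_getVert_succ hil
      rcases hdeg _ _ _ _ h1.symm h2 hst with h | h | h
      · have := hw.getVert_injOn (show j ≤ w.length by omega) (show j + 1 + 1 ≤ w.length by omega) h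
        omega
      · rw [← h]
        exact w.getVert_mem_support _
      · rw [← h]
        exact w.getVert_mem_support _
  have hreach : ∀ s t, H.Reachable s t → s ∈ w.support → t ∈ w.support := by
    rintro s t ⟨q⟩
    induction q with
    | nil => exact id
    | cons hadj _ ih => exact fun hs => ih (hclosed _ hs _ hadj)
  have hsupp : ∀ s, s ∈ w.support ↔ s ∈ c.supp := by
    intro s
    rw [SimpleGraph.ConnectedComponent.mem_supp_iff, ← hac, SimpleGraph.ConnectedComponent.eq]
    constructor
    · intro hs
      exact (w.takeUntil s hs).reverse.reachable
    · intro hs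
      exact hreach a s hs.symm w.start_mem_support
  refine ⟨a, b, w, hw, SimpleGraph.Subgraph.ext ?_ ?_⟩
  · ext s
    rw [SimpleGraph.Walk.mem_verts_toSubgraph, hsupp]
    rfl
  · ext s t
    rw [SimpleGraph.Walk.adj_toSubgraph_iff_mem_edges, SimpleGraph.Subgraph.induce_adj, ← hsupp,
      ← hsupp, SimpleGraph.Subgraph.top_adj]
    constructor
    · intro h
      exact ⟨w.fst_mem_support_of_mem_edges h, w.snd_mem_support_of_mem_edges h,
        w.adj_of_mem_edges h⟩
    · rintro ⟨hs, ht, hst⟩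
      exact hpath a b w hw s hs t ht hst

/-- An integral feasible point of the path packing program is the indicator of a semi-path. -/
lemma exists_mem_semiPathSizes_of_mem_ppValues {z : ℤ} (hz : z ∈ ppValues G ℤ) :
    ∃ k : ℕ, (k : ℤ) = z ∧ k ∈ semiPathSizes G := by
  classical
  obtain ⟨x, hx, rfl⟩ := hz
  -- The set of the two endpoints has right-hand side `2 - 1`.
  have hle1 : ∀ e, x e ≤ 1 := by
    intro e
    have hd := G.not_isDiag_of_mem_edgeSet e.2
    have h := hx.subset_le e.1.toFinset (Sym2.card_toFinset_of_not_isDiag _ hd).ge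
    rw [Sym2.card_toFinset_of_not_isDiag _ hd] at h
    refine le_trans (Finset.single_le_sum (f := x) (fun e _ => hx.nonneg e) ?_) h
    simp
  have hcount : ∀ (q : G.edgeSet → Prop) {_ : DecidablePred q} (B : Finset (Sym2 (Fin n))),
      (∀ e ∈ B, ∃ h : e ∈ G.edgeSet, x ⟨e, h⟩ = 1 ∧ q ⟨e, h⟩) → ∀ N : ℤ,
      ∑ e ∈ (Finset.univ : Finset G.edgeSet) with q e, x e ≤ N → (B.card : ℤ) ≤ N := by
    intro q _ B hB N hN
    let B' : Finset G.edgeSet := {e | e.1 ∈ B}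
    have hBB' : B ⊆ B'.image Subtype.val := by
      intro e he
      obtain ⟨h, -⟩ := hB e he
      exact Finset.mem_image.2 ⟨⟨e, h⟩, by simp [B', he], rfl⟩
    have hmem : ∀ e ∈ B', x e = 1 ∧ q e := by
      intro e he
      obtain ⟨h, h'⟩ := hB e.1 (by simpa [B'] using he)
      exact h'
    have h1 : (B.card : ℤ) ≤ B'.card := by
      exact_mod_cast (Finset.card_le_card hBB').trans Finset.card_image_le
    have h2 : (B'.card : ℤ) = ∑ e ∈ B', x e := by
      rw [Finset.sum_congr rfl fun e he => (hmem e he).1]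
      simp
    have h3 : ∑ e ∈ B', x e ≤ ∑ e ∈ (Finset.univ : Finset G.edgeSet) with q e, x e :=
      Finset.sum_le_sum_of_subset_of_nonneg (fun e he => by simp [(hmem e he).2])
        fun e _ _ => hx.nonneg e
    linarith
  let P : G.Subgraph :=
    { verts := Set.univ
      Adj := fun u v => ∃ h : G.Adj u v, x ⟨s(u, v), h⟩ = 1
      adj_sub := fun ⟨h, _⟩ => h
      edge_vert := fun _ => Set.mem_univ _
      symm := ⟨fun u v ⟨h, h'⟩ => ⟨h.symm, by
        rw [← h']
        congr 2
        exact Sym2.eq_swap⟩⟩ }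
  have hPedge : ∀ e, e ∈ P.edgeSet ↔ ∃ h : e ∈ G.edgeSet, x ⟨e, h⟩ = 1 := by
    intro e
    induction e using Sym2.ind with
    | _ u v => exact SimpleGraph.Subgraph.mem_edgeSet
  have hval : (P.edgeSet.ncard : ℤ) = ∑ e, x e := by
    have himg : P.edgeSet = ((Finset.univ.filter fun e : G.edgeSet => x e = 1).image Subtype.val :
        Finset (Sym2 (Fin n))) := by
      ext e
      rw [hPedge]
      simp
    rw [himg, Set.ncard_coe_finset, Finset.card_image_of_injective _ Subtype.val_injective,
      Finset.card_eq_sum_ones, Finset.sum_filter]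
    push_cast
    refine Finset.sum_congr rfl fun e _ => ?_
    have h1 := hle1 e
    have h2 := hx.nonneg e
    split_ifs <;> omega
  refine ⟨_, hval, P, ?_, rfl⟩
  refine exists_isPath_toSubgraph_eq_induce_supp P.coe ?_ ?_
  · rintro v a b c hva hvb hvc
    by_contra! hne
    have hne' : ∀ {a b : P.verts}, a ≠ b → s(v.1, a.1) ≠ s(v.1, b.1) := by
      intro a b hab h
      exact hab (Subtype.ext (Sym2.congr_right.1 h))
    have h := hcount (fun e => v.1 ∈ e.1) {s(v.1, a.1), s(v.1, b.1), s(v.1, c.1)} (by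
      intro e he
      simp only [Finset.mem_insert, Finset.mem_singleton] at he
      rcases he with rfl | rfl | rfl
      · exact ⟨hva.1, hva.2, by simp⟩
      · exact ⟨hvb.1, hvb.2, by simp⟩
      · exact ⟨hvc.1, hvc.2, by simp⟩) _ (hx.vertex_le v.1)
    rw [Finset.card_eq_three.2 ⟨_, _, _, hne' hne.1, hne' hne.2.1, hne' hne.2.2, rfl⟩] at h
    norm_num at h
  · intro a b w hw s hs t ht hst
    by_contra hnot
    let w' := w.map P.hom
    have hinj : Function.Injective P.hom := Subtype.val_injective
    have hw' : w'.IsPath := hw.map hinj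
    let U := w'.support.toFinset
    have hUcard : U.card = w.length + 1 := by
      rw [List.toFinset_card_of_nodup hw'.support_nodup, SimpleGraph.Walk.length_support,
        SimpleGraph.Walk.length_map]
    have hmemU : ∀ y ∈ w.support, y.1 ∈ U := by
      intro y hy
      rw [List.mem_toFinset, SimpleGraph.Walk.support_map, List.mem_map]
      exact ⟨y, hy, rfl⟩
    have h2 : 2 ≤ U.card := Finset.one_lt_card.2
      ⟨s.1, hmemU s hs, t.1, hmemU t ht, fun h => hst.ne (Subtype.ext h)⟩
    have hnotin : s(s.1, t.1) ∉ w'.edges.toFinset := by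
      rw [List.mem_toFinset, SimpleGraph.Walk.edges_map, List.mem_map]
      rintro ⟨e, he, h⟩
      have : e = s(s, t) := Sym2.map.injective hinj h
      exact hnot (this ▸ he)
    -- A chord together with the edges of the path would give `|U|` chosen edges inside `U`.
    have h := hcount (fun e => ∀ v ∈ e.1, v ∈ U) (insert s(s.1, t.1) w'.edges.toFinset) (by
      intro e he
      rw [Finset.mem_insert] at he
      rcases he with rfl | he
      · refine ⟨hst.1, hst.2, fun v hv => ?_⟩
        rcases Sym2.mem_iff.1 hv with rfl | rfl
        · exact hmemU s hs
        · exact hmemU t ht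
      · have he' := List.mem_toFinset.1 he
        have hU : ∀ v ∈ e, v ∈ U := fun v hv =>
          List.mem_toFinset.2 (w'.mem_support_of_mem_edges he' hv)
        rw [SimpleGraph.Walk.edges_map, List.mem_map] at he'
        obtain ⟨e, hew, rfl⟩ := he'
        have heP := w.edges_subset_edgeSet hew
        clear hew he
        induction e using Sym2.ind with
        | _ u v => exact ⟨heP.1, heP.2, hU⟩) _ (hx.subset_le U h2)
    rw [Finset.card_insert_of_notMem hnotin, List.toFinset_card_of_nodup hw'.edges_nodup,
      SimpleGraph.Walk.length_edges, SimpleGraph.Walk.length_map, hUcard] at h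
    push_cast at h
    omega

/-- The number `r(G)`, the integer optimum of the path packing program and the binomial grade
agree. -/
theorem exists_isGreatest_semiPathSizes (G : SimpleGraph (Fin n)) :
    ∃ r : ℕ, IsGreatest (semiPathSizes G) r ∧ IsGreatest (ppValues G ℤ) (r : ℤ) ∧
      ∀ (K : Type u) [Field K],
        IsGreatest (binomialRegularLengths (binomialEdgeIdeal K G)) r := by
  have hne : (semiPathSizes G).Nonempty := by
    refine ⟨_, ⊥, fun c => ?_, rfl⟩
    obtain ⟨v, -⟩ := c.exists_rep
    exact absurd v.2 (Set.notMem_empty _)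
  have hfin : (semiPathSizes G).Finite := by
    refine (Set.finite_Iic (G.edgeSet.ncard)).subset ?_
    rintro _ ⟨P, -, rfl⟩
    exact Set.ncard_le_ncard P.edgeSet_subset (Set.toFinite _)
  obtain ⟨r, hr, hmax⟩ := hfin.exists_maximalFor id _ hne
  have hmax' : ∀ k ∈ semiPathSizes G, k ≤ r := fun k hk => (le_total k r).elim id (hmax hk)
  have hpp : ∀ z ∈ ppValues G ℤ, z ≤ r := by
    intro z hz
    obtain ⟨k, rfl, hk⟩ := exists_mem_semiPathSizes_of_mem_ppValues hz
    exact_mod_cast hmax' k hk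
  -- Feasibility of a semi-path is obtained through its regular sequence; `ℚ` is an arbitrary choice
  -- of field here.
  refine ⟨r, ⟨hr, hmax'⟩, ⟨binomialRegularLengths_subset (K := ℚ)
    (mem_binomialRegularLengths_of_mem_semiPathSizes ℚ hr), hpp⟩, fun K _ =>
    ⟨mem_binomialRegularLengths_of_mem_semiPathSizes K hr, fun k hk => ?_⟩⟩
  exact_mod_cast hpp k (binomialRegularLengths_subset hk)

end SemiPaths

/-! ### F-thresholds -/

section FrobeniusPowers

open MvPolynomial

variable {σ : Type} {K : Type u} [Field K]

lemma mem_frobeniusPowerMax_iff {q : ℕ} {f : MvPolynomial σ K} :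
    f ∈ frobeniusPowerMax σ K q ↔ ∀ m ∈ f.support, ∃ i, q ≤ m i := by
  have h : (Set.range fun i : σ => (X i : MvPolynomial σ K) ^ q) =
      (fun s => monomial s (1 : K)) '' Set.range fun i => Finsupp.single i q := by
    ext f
    simp [X_pow_eq_monomial]
  rw [frobeniusPowerMax, h, mem_ideal_span_monomial_image]
  simp

/-- The `K`-linear map that divides a monomial by `X ^ b` and extracts a `q`-th root (and is zero
on the monomials where that is impossible). -/
noncomputable def rootMap (K : Type u) [Field K] (q : ℕ) (b : σ →₀ ℕ) :
    MvPolynomial σ K →ₗ[K] MvPolynomial σ K :=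
  open Classical in
  (basisMonomials σ K).constr K fun m =>
    if h : ∃ v : σ →₀ ℕ, m = q • v + b then monomial h.choose 1 else 0

variable {q : ℕ} {b : σ →₀ ℕ}

lemma rootMap_monomial_add (hq : 0 < q) (v : σ →₀ ℕ) (r : K) :
    rootMap K q b (monomial (q • v + b) r) = monomial v r := by
  have h : ∃ v' : σ →₀ ℕ, q • v + b = q • v' + b := ⟨v, rfl⟩
  have key : ∀ v' : σ →₀ ℕ, q • v + b = q • v' + b → v' = v := by
    intro v' h
    ext i
    have := DFunLike.congr_fun h i
    simp only [Finsupp.add_apply, Finsupp.smul_apply, smul_eq_mul, add_left_inj] at this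
    exact (Nat.eq_of_mul_eq_mul_left hq this).symm
  have hv : h.choose = v := key _ h.choose_spec
  have h1 : rootMap K q b (monomial (q • v + b) 1) = monomial v 1 := by
    have := (basisMonomials σ K).constr_basis K (fun m =>
      open Classical in if h : ∃ v : σ →₀ ℕ, m = q • v + b then
        (monomial h.choose 1 : MvPolynomial σ K) else 0) (q • v + b)
    rw [coe_basisMonomials] at this
    refine this.trans ?_
    rw [dif_pos h, hv]
  rw [← mul_one r, ← smul_eq_mul, ← smul_monomial, map_smul, h1, smul_monomial]

lemma rootMap_monomial_of_not {m : σ →₀ ℕ} (h : ¬ ∃ v : σ →₀ ℕ, m = q • v + b) (r : K) :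
    rootMap K q b (monomial m r) = 0 := by
  have h1 : rootMap K q b (monomial m 1) = 0 := by
    have := (basisMonomials σ K).constr_basis K (fun m =>
      open Classical in if h : ∃ v : σ →₀ ℕ, m = q • v + b then
        (monomial h.choose 1 : MvPolynomial σ K) else 0) m
    rw [coe_basisMonomials] at this
    refine this.trans ?_
    rw [dif_neg h]
  rw [← mul_one r, ← smul_eq_mul, ← smul_monomial, map_smul, h1, smul_zero]

lemma constantCoeff_rootMap (hq : 0 < q) (f : MvPolynomial σ K) :
    constantCoeff (rootMap K q b f) = coeff b f := by
  classical
  induction f using MvPolynomial.induction_on' with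
  | monomial m r =>
    by_cases h : ∃ v : σ →₀ ℕ, m = q • v + b
    · obtain ⟨v, rfl⟩ := h
      rw [rootMap_monomial_add hq, constantCoeff_monomial, coeff_monomial]
      have : q • v + b = b ↔ v = 0 := by simp [hq.ne']
      simp only [this]
    · rw [rootMap_monomial_of_not h, map_zero, coeff_monomial, if_neg]
      rintro rfl
      exact h ⟨0, by simp⟩
  | add f g hf hg => rw [map_add, map_add, hf, hg, coeff_add]

/-- If `q u + m = q v + b` and all `b i < q`, then `u ≤ v`; so a factor in the image of `expand q`
passes through the root without creating new divisible monomials. -/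
lemma rootMap_expand_mul (hb : ∀ i, b i < q) (hq : 0 < q) (h f : MvPolynomial σ K) :
    rootMap K q b (expand q h * f) = h * rootMap K q b f := by
  induction h using MvPolynomial.induction_on' with
  | monomial u r =>
    induction f using MvPolynomial.induction_on' with
    | monomial m s =>
      rw [expand_monomial, monomial_mul]
      by_cases hm : ∃ v : σ →₀ ℕ, m = q • v + b
      · obtain ⟨v, rfl⟩ := hm
        rw [rootMap_monomial_add hq, monomial_mul, ← add_assoc, ← smul_add,
          rootMap_monomial_add hq]
      · rw [rootMap_monomial_of_not hm, mul_zero, rootMap_monomial_of_not]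
        rintro ⟨v, hv⟩
        refine hm ⟨v - u, ?_⟩
        ext i
        have hi := DFunLike.congr_fun hv i
        simp only [Finsupp.add_apply, Finsupp.smul_apply, smul_eq_mul, Finsupp.tsub_apply] at hi ⊢
        have huv : u i ≤ v i := by
          by_contra! hlt
          have h1 : q * (v i + 1) ≤ q * u i := Nat.mul_le_mul_left q hlt
          have h2 := hb i
          rw [mul_add] at h1
          omega
        obtain ⟨d, hd⟩ := Nat.exists_eq_add_of_le huv
        rw [hd, mul_add] at hi
        rw [hd, Nat.add_sub_cancel_left]
        omega
    | add f g hf hg => rw [mul_add, map_add, hf, hg, map_add, mul_add]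
  | add g h hg hh => rw [map_add, add_mul, map_add, hg, hh, add_mul]

/-- Colon property of Frobenius powers: an element whose multiple by a power of `x` lies in the
Frobenius power of a subideal of a prime, which does not contain `x`, has no monomials with small
exponents. -/
lemma mem_frobeniusPowerMax_of_mul_mem {P : Ideal (MvPolynomial σ K)} [P.IsPrime]
    (hP : P ≤ RingHom.ker constantCoeff) (hq : 0 < q) {s : Set (MvPolynomial σ K)}
    (hs : ∀ f ∈ s, f ∈ P) {x : σ} (hx : X x ∉ P) {N : ℕ} {g : MvPolynomial σ K}
    (hg : X x ^ N * g ∈ Ideal.span (expand q '' s)) : g ∈ frobeniusPowerMax σ K q := by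
  rw [mem_frobeniusPowerMax_iff]
  intro b hbg
  by_contra! hb
  have hroot : ∀ f ∈ Ideal.span (expand (R := K) q '' s), ∀ c, rootMap K q b (c * f) ∈ P := by
    intro f hf
    induction hf using Submodule.span_induction with
    | mem f hf =>
      obtain ⟨f, hf, rfl⟩ := hf
      intro c
      rw [mul_comm, rootMap_expand_mul hb hq]
      exact P.mul_mem_right _ (hs f hf)
    | zero => simp
    | add f g _ _ hf hg =>
      intro c
      rw [mul_add, map_add]
      exact P.add_mem (hf c) (hg c)
    | smul a f _ hf =>
      intro c
      rw [smul_eq_mul, ← mul_assoc]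
      exact hf _
  have hqN : N ≤ q * N := Nat.le_mul_of_pos_left _ hq
  -- Raising the exponent from `N` to `q N` puts the power of the variable into the image of `expand
  -- q`.
  have h1 : expand q (X x ^ N) * g ∈ Ideal.span (expand (R := K) q '' s) := by
    have : expand q (X x ^ N : MvPolynomial σ K) * g = X x ^ (q * N - N) * (X x ^ N * g) := by
      rw [map_pow, expand_X, ← pow_mul, ← mul_assoc, ← pow_add, Nat.sub_add_cancel hqN]
    rw [this]
    exact Ideal.mul_mem_left _ _ hg
  have h2 := hroot _ h1 1
  rw [one_mul, rootMap_expand_mul hb hq] at h2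
  have h3 := (Ideal.IsPrime.mem_or_mem ‹_› h2).resolve_left
    fun h => hx (Ideal.IsPrime.mem_of_pow_mem ‹_› _ h)
  have h4 : constantCoeff (rootMap K q b g) = 0 := hP h3
  rw [constantCoeff_rootMap hq] at h4
  exact mem_support_iff.1 hbg h4

/-- In characteristic `p`, Frobenius is `expand p` followed by Frobenius on the coefficients. -/
lemma coeff_smul_pow_char (p : ℕ) [Fact p.Prime] [CharP K p] (f : MvPolynomial σ K)
    (m : σ →₀ ℕ) : coeff (p • m) (f ^ p) = coeff m f ^ p := by
  have h : frobenius (MvPolynomial σ K) p =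
      (map (frobenius K p)).comp (expand (σ := σ) (R := K) p).toRingHom := by
    refine ringHom_ext (fun r => ?_) (fun i => ?_)
    · simp [frobenius_def]
    · simp [frobenius_def]
  have h1 : f ^ p = map (frobenius K p) (expand p f) := congrArg (fun φ : _ →+* _ => φ f) h
  rw [h1, coeff_map, coeff_expand_smul _ (Fact.out : p.Prime).ne_zero, frobenius_def]

lemma pow_le_of_forall_prod_mem {R ι : Type*} [CommRing R] [Fintype ι] (f : ι → R) (r : ℕ)
    (M : Ideal R) (h : ∀ a : ι → ℕ, ∑ i, a i = r → ∏ i, f i ^ a i ∈ M) :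
    Ideal.span (Set.range f) ^ r ≤ M := by
  classical
  induction r generalizing M with
  | zero =>
    have := h 0 (by simp)
    simp only [Pi.zero_apply, pow_zero, Finset.prod_const_one] at this
    rw [(Ideal.eq_top_iff_one M).2 this]
    exact le_top
  | succ r ih =>
    rw [pow_succ, Ideal.mul_le]
    intro x hx y hy
    induction hy using Submodule.span_induction with
    | mem y hy =>
      obtain ⟨j, rfl⟩ := hy
      -- Induction is applied to the colon ideal of `M` by `f j`.
      refine ih (Submodule.comap (LinearMap.mulRight R (f j)) M) (fun a ha => ?_) hx
      have := h (a + Pi.single j 1) (by simp [Finset.sum_add_distrib, ha])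
      simp only [Pi.add_apply, pow_add, Finset.prod_mul_distrib] at this
      rwa [Finset.prod_eq_single (f := fun i => f i ^ (Pi.single j 1 : ι → ℕ) i) j
        (fun i _ hi => by simp [hi]) (by simp), Pi.single_eq_same, pow_one] at this
    | zero => simp
    | add y z _ _ hy hz =>
      rw [mul_add]
      exact M.add_mem hy hz
    | smul a y _ hy =>
      rw [smul_eq_mul, mul_left_comm]
      exact M.mul_mem_left _ hy

/-- Pigeonhole: in a product of more than `(q - 1)` times the number of generators, some generator
occurs at least `q` times. -/
lemma pow_le_span_pow {R ι : Type*} [CommRing R] [Fintype ι] (f : ι → R) {r q : ℕ}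
    (h : Fintype.card ι * (q - 1) < r) :
    Ideal.span (Set.range f) ^ r ≤ Ideal.span (Set.range fun i => f i ^ q) := by
  classical
  refine pow_le_of_forall_prod_mem f r _ fun a ha => ?_
  obtain ⟨i, hi⟩ : ∃ i, q ≤ a i := by
    by_contra! hlt
    have : ∑ i, a i ≤ ∑ _i : ι, (q - 1) := Finset.sum_le_sum fun i _ => by
      have := hlt i
      omega
    rw [Finset.sum_const, smul_eq_mul, Finset.card_univ, ha] at this
    omega
  rw [← Finset.mul_prod_erase _ _ (Finset.mem_univ i)]
  refine Ideal.mul_mem_right _ _ ?_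
  rw [← Nat.sub_add_cancel hi, pow_add]
  exact Ideal.mul_mem_left _ _ (Ideal.subset_span ⟨i, rfl⟩)

lemma exists_of_mem_support_pow {A B m : σ →₀ ℕ} (a : ℕ)
    (h : m ∈ ((monomial A 1 - monomial B 1 : MvPolynomial σ K) ^ a).support) :
    ∃ β γ, β + γ = a ∧ m = β • A + γ • B := by
  classical
  induction a generalizing m with
  | zero =>
    refine ⟨0, 0, rfl, ?_⟩
    rw [pow_zero] at h
    simpa using (support_monomial_subset h)
  | succ a ih =>
    rw [pow_succ] at h
    obtain ⟨m₁, h₁, m₂, h₂, rfl⟩ := Finset.mem_add.1 (support_mul _ _ h)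
    obtain ⟨β, γ, rfl, rfl⟩ := ih h₁
    rcases Finset.mem_union.1 (support_sub _ _ _ h₂) with h₂ | h₂
    · obtain rfl : m₂ = A := by simpa using support_monomial_subset h₂
      exact ⟨β + 1, γ, by omega, by rw [add_smul, one_smul]; abel⟩
    · obtain rfl : m₂ = B := by simpa using support_monomial_subset h₂
      exact ⟨β, γ + 1, by omega, by rw [add_smul, one_smul]; abel⟩

lemma exists_of_mem_support_prod_pow {ι : Type*} (s : Finset ι) (A B : ι → σ →₀ ℕ) (a : ι → ℕ)
    {m : σ →₀ ℕ}
    (h : m ∈ (∏ i ∈ s, (monomial (A i) 1 - monomial (B i) 1 : MvPolynomial σ K) ^ a i).support) :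
    ∃ β γ : ι → ℕ, (∀ i ∈ s, β i + γ i = a i) ∧ m = ∑ i ∈ s, (β i • A i + γ i • B i) := by
  classical
  induction s using Finset.induction_on generalizing m with
  | empty =>
    refine ⟨0, 0, by simp, ?_⟩
    rw [Finset.prod_empty] at h
    simpa using (support_monomial_subset h)
  | insert j s hj ih =>
    rw [Finset.prod_insert hj] at h
    obtain ⟨m₁, h₁, m₂, h₂, rfl⟩ := Finset.mem_add.1 (support_mul _ _ h)
    obtain ⟨β₁, γ₁, h₁a, rfl⟩ := exists_of_mem_support_pow _ h₁
    obtain ⟨β, γ, ha, rfl⟩ := ih h₂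
    have hne : ∀ i ∈ s, i ≠ j := fun i hi h => hj (h ▸ hi)
    refine ⟨Function.update β j β₁, Function.update γ j γ₁, fun i hi => ?_, ?_⟩
    · rcases Finset.mem_insert.1 hi with rfl | hi
      · simpa using h₁a
      · simpa [hne i hi] using ha i hi
    · rw [Finset.sum_insert hj]
      congr 1
      · simp
      · refine Finset.sum_congr rfl fun i hi => ?_
        simp [hne i hi]

end FrobeniusPowers

/-! ### F-thresholds of binomial edge ideals -/

section FThreshold

open MvPolynomial

variable {n : ℕ} {G : SimpleGraph (Fin n)} {K : Type u} [Field K]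

/-- Multiplied by `X_{u₀}`, every minor inside `U` lies in the ideal of the `|U| - 1` minors with
`u₀`. The pigeonhole bound moves a large product into the ideal of their `q`-th powers, and the
colon property removes the power of `X_{u₀}`, a variable outside the determinantal prime of `U`. -/
lemma prod_minor_pow_mem_frobeniusPowerMax (p : ℕ) [Fact p.Prime] [CharP K p] (k : ℕ)
    {U : Finset (Fin n)} (hU : U.Nonempty) {ι : Type*} (A : Finset ι) (i j : ι → Fin n)
    (hi : ∀ e ∈ A, i e ∈ U) (hj : ∀ e ∈ A, j e ∈ U) (a : ι → ℕ)
    (ha : (U.card - 1) * (p ^ k - 1) < ∑ e ∈ A, a e) :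
    ∏ e ∈ A, minor K (i e) (j e) ^ a e ∈ frobeniusPowerMax (Fin n ⊕ Fin n) K (p ^ k) := by
  classical
  obtain ⟨u₀, hu₀⟩ := hU
  obtain ⟨P, hP, -, hPX, hPU, hPc⟩ := exists_isPrime_height_le K ∅ {U} (by
    simpa using ⟨u₀, hu₀⟩)
  let f : {u // u ∈ U.erase u₀} → MvPolynomial (Fin n ⊕ Fin n) K := fun u => minor K u₀ u
  have hf : ∀ u ∈ U, minor K u₀ u ∈ Ideal.span (Set.range f) := by
    intro u hu
    by_cases h : u = u₀
    · rw [h, minor_self]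
      exact Ideal.zero_mem _
    · exact Ideal.subset_span ⟨⟨u, Finset.mem_erase.2 ⟨h, hu⟩⟩, rfl⟩
  have hmem : X (Sum.inl u₀) ^ (∑ e ∈ A, a e) * ∏ e ∈ A, minor K (i e) (j e) ^ a e ∈
      Ideal.span (Set.range f) ^ (∑ e ∈ A, a e) := by
    rw [← Finset.prod_pow_eq_pow_sum, ← Finset.prod_pow_eq_pow_sum, ← Finset.prod_mul_distrib]
    refine Ideal.prod_mem_prod fun e he => ?_
    rw [← mul_pow]
    refine Ideal.pow_mem_pow ?_ _
    have : X (Sum.inl u₀) * minor K (i e) (j e) =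
        X (Sum.inl (i e)) * minor K u₀ (j e) - X (Sum.inl (j e)) * minor K u₀ (i e) := by
      simp only [minor]
      ring
    rw [this]
    exact Ideal.sub_mem _ (Ideal.mul_mem_left _ _ (hf _ (hj e he)))
      (Ideal.mul_mem_left _ _ (hf _ (hi e he)))
  have hspan := pow_le_span_pow f (r := ∑ e ∈ A, a e) (q := p ^ k) (by
    rwa [Fintype.card_coe, Finset.card_erase_of_mem hu₀]) hmem
  have hexp : (Set.range fun u => f u ^ p ^ k) = expand (p ^ k) '' Set.range f := by
    rw [← Set.range_comp]
    congr 1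
    ext1 u
    have : ExpChar (MvPolynomial (Fin n ⊕ Fin n) K) p := .prime Fact.out
    simp only [f, minor, Function.comp_apply, sub_pow_expChar_pow, mul_pow, map_sub, map_mul,
      expand_X]
  rw [hexp] at hspan
  refine mem_frobeniusPowerMax_of_mul_mem hPc (pow_pos (Fact.out : p.Prime).pos k) ?_
    (fun h => Finset.notMem_empty u₀ ((hPX u₀).1.1 h)) hspan
  rintro _ ⟨u, rfl⟩
  exact hPU U (Finset.mem_singleton_self U) u₀ hu₀ u (Finset.mem_of_mem_erase u.2)

/-- If `J_G ^ r` is not contained in `𝔪^{[q]}`, then `r / q` is a value of the program `LP`. -/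
lemma div_mem_lpValues (p : ℕ) [Fact p.Prime] [CharP K p] (k r : ℕ)
    (h : ¬ binomialEdgeIdeal K G ^ r ≤ frobeniusPowerMax (Fin n ⊕ Fin n) K (p ^ k)) :
    (r : ℚ) / (p : ℚ) ^ k ∈ lpValues G ℚ := by
  classical
  have hends : ∀ e : G.edgeSet, ∃ i j, i < j ∧ e.1 = s(i, j) := by
    rintro ⟨e, he⟩
    induction e using Sym2.ind with
    | _ u v =>
    rcases lt_or_gt_of_ne (G.ne_of_adj he) with h | h
    · exact ⟨u, v, h, rfl⟩
    · exact ⟨v, u, h, Sym2.eq_swap⟩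
  choose lo hi hlt he using hends
  have hJ : binomialEdgeIdeal K G = Ideal.span (Set.range fun e => minor K (lo e) (hi e)) := by
    refine le_antisymm ?_ ?_
    · rw [binomialEdgeIdeal, Ideal.span_le]
      rintro _ ⟨i, j, hij, hadj, rfl⟩
      refine Ideal.subset_span ⟨⟨s(i, j), hadj⟩, ?_⟩
      have h1 := he ⟨s(i, j), hadj⟩
      have h2 := hlt ⟨s(i, j), hadj⟩
      dsimp only at h1 ⊢
      rcases Sym2.eq_iff.1 h1 with ⟨h3, h4⟩ | ⟨h3, h4⟩
      · rw [← h3, ← h4]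
        rfl
      · rw [← h3, ← h4] at h2
        exact absurd hij (not_lt.2 h2.le)
    · rw [Ideal.span_le]
      rintro _ ⟨e, rfl⟩
      refine minor_mem_binomialEdgeIdeal G K ?_
      have := e.2
      rwa [he e] at this
  obtain ⟨a, har, ha⟩ : ∃ a : G.edgeSet → ℕ, ∑ e, a e = r ∧
      ∏ e, minor K (lo e) (hi e) ^ a e ∉ frobeniusPowerMax (Fin n ⊕ Fin n) K (p ^ k) := by
    by_contra! hall
    rw [hJ] at h
    exact h (pow_le_of_forall_prod_mem _ _ _ hall)
  have hsub : ∀ U : Finset (Fin n), 2 ≤ U.card →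
      ∑ e ∈ (Finset.univ : Finset G.edgeSet) with (∀ v ∈ e.1, v ∈ U), a e ≤
        (U.card - 1) * (p ^ k - 1) := by
    intro U hU
    by_contra! hlt'
    have := prod_minor_pow_mem_frobeniusPowerMax (K := K) p k
      (Finset.card_pos.1 (by omega)) ({e : G.edgeSet | ∀ v ∈ e.1, v ∈ U} : Finset G.edgeSet) lo hi
      (fun e h => (Finset.mem_filter.1 h).2 (lo e) (by rw [he]; simp))
      (fun e h => (Finset.mem_filter.1 h).2 (hi e) (by rw [he]; simp)) a hlt'
    refine ha ?_
    rw [← Finset.prod_filter_mul_prod_filter_not Finset.univ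
      (fun e : G.edgeSet => ∀ v ∈ e.1, v ∈ U)]
    exact Ideal.mul_mem_right _ _ this
  obtain ⟨m, hm, hmq⟩ : ∃ m ∈ (∏ e, minor K (lo e) (hi e) ^ a e).support, ∀ i, m i < p ^ k := by
    rw [mem_frobeniusPowerMax_iff] at ha
    push Not at ha
    exact ha
  simp only [minor_eq_monomial] at hm
  -- For the edge `e`, the term `X_lo Y_hi` was chosen `β e` times and `X_hi Y_lo` was chosen `γ e`
  -- times. The exponents of `X_v` and `Y_v` are then the two vertex sums of `LP`.
  obtain ⟨β, γ, hβγ, rfl⟩ := exists_of_mem_support_prod_pow _ _ _ _ hm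
  have hq : (0 : ℚ) < (p : ℚ) ^ k := by
    have := (Fact.out : p.Prime).pos
    positivity
  have hlo : ∀ (x : G.edgeSet → ℕ) v,
      ∑ e ∈ (Finset.univ : Finset G.edgeSet) with (∃ w, v < w ∧ e.1 = s(v, w)),
        (x e : ℚ) / (p : ℚ) ^ k = ((∑ e, if lo e = v then x e else 0 : ℕ) : ℚ) / (p : ℚ) ^ k := by
    intro x v
    rw [← Finset.sum_div, ← Finset.sum_filter]
    push_cast
    congr 1
    refine Finset.sum_congr (Finset.filter_congr fun e _ => ?_) fun _ _ => rfl
    constructor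
    · rintro ⟨w, hw, h⟩
      rw [he e, Sym2.eq_iff] at h
      rcases h with ⟨h, -⟩ | ⟨h1, h2⟩
      · exact h
      · have := hlt e
        rw [h1, h2] at this
        exact absurd hw (not_lt.2 this.le)
    · rintro rfl
      exact ⟨hi e, hlt e, he e⟩
  have hhi : ∀ (x : G.edgeSet → ℕ) v,
      ∑ e ∈ (Finset.univ : Finset G.edgeSet) with (∃ w, w < v ∧ e.1 = s(w, v)),
        (x e : ℚ) / (p : ℚ) ^ k = ((∑ e, if hi e = v then x e else 0 : ℕ) : ℚ) / (p : ℚ) ^ k := by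
    intro x v
    rw [← Finset.sum_div, ← Finset.sum_filter]
    push_cast
    congr 1
    refine Finset.sum_congr (Finset.filter_congr fun e _ => ?_) fun _ _ => rfl
    constructor
    · rintro ⟨w, hw, h⟩
      rw [he e, Sym2.eq_iff] at h
      rcases h with ⟨-, h⟩ | ⟨h1, h2⟩
      · exact h
      · have := hlt e
        rw [h1, h2] at this
        exact absurd hw (not_lt.2 this.le)
    · rintro rfl
      exact ⟨lo e, hlt e, he e⟩
  have hminl : ∀ (i j v : Fin n), minorExp i j (Sum.inl v) = if i = v then 1 else 0 := by
    intro i j v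
    simp [minorExp, Finsupp.single_apply]
  have hminr : ∀ (i j v : Fin n), minorExp i j (Sum.inr v) = if j = v then 1 else 0 := by
    intro i j v
    simp [minorExp, Finsupp.single_apply]
  refine ⟨fun e => (β e : ℚ) / (p : ℚ) ^ k, fun e => (γ e : ℚ) / (p : ℚ) ^ k,
    ⟨fun e => by positivity, fun e => by positivity, fun U hU => ?_, fun v => ?_, fun v => ?_⟩, ?_⟩
  · have h1 := hsub U hU
    have h2 : (∑ e ∈ (Finset.univ : Finset G.edgeSet) with (∀ v ∈ e.1, v ∈ U),
        ((β e : ℚ) / (p : ℚ) ^ k + (γ e : ℚ) / (p : ℚ) ^ k)) =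
        ((∑ e ∈ (Finset.univ : Finset G.edgeSet) with (∀ v ∈ e.1, v ∈ U), a e : ℕ) : ℚ) /
          (p : ℚ) ^ k := by
      push_cast
      rw [Finset.sum_div]
      refine Finset.sum_congr rfl fun e _ => ?_
      rw [← hβγ e (Finset.mem_univ e)]
      push_cast
      ring
    have h3 : ((∑ e ∈ (Finset.univ : Finset G.edgeSet) with (∀ v ∈ e.1, v ∈ U), a e : ℕ) : ℚ) /
          (p : ℚ) ^ k ≤ (U.card : ℚ) - 1 := by
      rw [div_le_iff₀ hq]
      have h4 : (U.card - 1) * (p ^ k - 1) ≤ (U.card - 1) * p ^ k :=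
        Nat.mul_le_mul_left _ (Nat.sub_le _ _)
      have h5 : ((U.card - 1 : ℕ) : ℚ) = (U.card : ℚ) - 1 := by
        rw [Nat.cast_sub (by omega), Nat.cast_one]
      rw [← h5]
      exact_mod_cast h1.trans h4
    convert h2.le.trans h3 using 3
  · have h1 := hlo β v
    have h2 := hhi γ v
    have h3 := hmq (Sum.inl v)
    simp only [Finsupp.coe_finsetSum, Finset.sum_apply, Finsupp.add_apply, Finsupp.smul_apply,
      hminl, smul_eq_mul, mul_ite, mul_one, mul_zero, Finset.sum_add_distrib] at h3
    have h4 := (congrArg₂ (· + ·) h1 h2).trans_le (show _ ≤ (1 : ℚ) by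
      rw [← add_div, div_le_one hq]
      exact_mod_cast h3.le)
    convert h4 using 3
  · have h1 := hlo γ v
    have h2 := hhi β v
    have h3 := hmq (Sum.inr v)
    simp only [Finsupp.coe_finsetSum, Finset.sum_apply, Finsupp.add_apply, Finsupp.smul_apply,
      hminr, smul_eq_mul, mul_ite, mul_one, mul_zero, Finset.sum_add_distrib] at h3
    have h4 := (congrArg₂ (· + ·) h1 h2).trans_le (show _ ≤ (1 : ℚ) by
      rw [← add_div, div_le_one hq, add_comm]
      exact_mod_cast h3.le)
    convert h4 using 3
  · rw [← har]
    push_cast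
    rw [Finset.sum_div]
    refine Finset.sum_congr rfl fun e _ => ?_
    rw [← hβγ e (Finset.mem_univ e)]
    push_cast
    ring

/-- If `f` has a monomial `m` with exponents below `q`, then `f ^ p` has the monomial `p • m`, with
exponents below `q p`. -/
lemma not_pow_le_frobeniusPowerMax_mul {σ : Type} (p : ℕ) [Fact p.Prime] [CharP K p]
    {I : Ideal (MvPolynomial σ K)} {q r : ℕ} (h : ¬ I ^ r ≤ frobeniusPowerMax σ K q) :
    ¬ I ^ (r * p) ≤ frobeniusPowerMax σ K (q * p) := by
  obtain ⟨f, hf, hfq⟩ := SetLike.not_le_iff_exists.1 h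
  rw [mem_frobeniusPowerMax_iff] at hfq
  push Not at hfq
  obtain ⟨m, hm, hmq⟩ := hfq
  have hp := (Fact.out : p.Prime).pos
  intro hle
  have hmem := hle (by rw [pow_mul]; exact Ideal.pow_mem_pow hf p : f ^ p ∈ I ^ (r * p))
  rw [mem_frobeniusPowerMax_iff] at hmem
  obtain ⟨i, hi⟩ := hmem (p • m) (by
    rw [mem_support_iff, coeff_smul_pow_char]
    exact pow_ne_zero _ (mem_support_iff.1 hm))
  rw [Finsupp.smul_apply, smul_eq_mul, mul_comm p] at hi
  exact absurd (Nat.le_of_mul_le_mul_right hi hp) (not_le.2 (hmq i))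

/-- An F-threshold exists and is at most `c` as soon as all the quotients `r / p ^ e` with
`I ^ r ⊄ 𝔪^{[p ^ e]}` are at most `c`. -/
lemma exists_isFThreshold_le {σ : Type} (p : ℕ) [Fact p.Prime] [CharP K p]
    {I : Ideal (MvPolynomial σ K)} {c : ℝ}
    (h : ∀ e r : ℕ, ¬ I ^ r ≤ frobeniusPowerMax σ K (p ^ e) → (r : ℝ) / (p : ℝ) ^ e ≤ c) :
    ∃ t : ℝ, IsFThreshold p I t ∧ t ≤ c := by
  have hp := (Fact.out : p.Prime).pos
  have hpe : ∀ e : ℕ, (0 : ℝ) < (p : ℝ) ^ e := fun e => by positivity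
  have hν : ∀ e, ∃ N, IsGreatest {r : ℕ | ¬ I ^ r ≤ frobeniusPowerMax σ K (p ^ e)} N := by
    intro e
    have hne : {r : ℕ | ¬ I ^ r ≤ frobeniusPowerMax σ K (p ^ e)}.Nonempty := by
      refine ⟨0, fun hle => ?_⟩
      have h1 := mem_frobeniusPowerMax_iff.1 (hle (by simp : (1 : MvPolynomial σ K) ∈ I ^ 0)) 0
        (by simp)
      obtain ⟨i, hi⟩ := h1
      have : 0 < p ^ e := pow_pos hp e
      rw [Finsupp.zero_apply] at hi
      omega
    have hfin : {r : ℕ | ¬ I ^ r ≤ frobeniusPowerMax σ K (p ^ e)}.Finite := by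
      refine (Set.finite_Iic ⌊c * (p : ℝ) ^ e⌋₊).subset fun r hr => ?_
      have := h e r hr
      rw [div_le_iff₀ (hpe e)] at this
      exact Nat.le_floor this
    obtain ⟨N, hN, hmax⟩ := hfin.exists_maximalFor id _ hne
    exact ⟨N, hN, fun r hr => (le_total r N).elim id (hmax hr)⟩
  choose ν hν using hν
  -- Frobenius gives `p ν_e ≤ ν_{e+1}`; the limit is the supremum of a bounded monotone sequence.
  have hmono : Monotone fun e => (ν e : ℝ) / (p : ℝ) ^ e := by
    refine monotone_nat_of_le_succ fun e => ?_
    rw [div_le_div_iff₀ (hpe e) (hpe (e + 1))]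
    have h1 : ν e * p ≤ ν (e + 1) := (hν (e + 1)).2 (by
      have := not_pow_le_frobeniusPowerMax_mul p (hν e).1
      rwa [← pow_succ] at this)
    have h2 : (ν e : ℝ) * p ≤ ν (e + 1) := by exact_mod_cast h1
    calc (ν e : ℝ) * (p : ℝ) ^ (e + 1) = (ν e * p) * (p : ℝ) ^ e := by ring
      _ ≤ _ := mul_le_mul_of_nonneg_right h2 (hpe e).le
  have hbound : ∀ e, (ν e : ℝ) / (p : ℝ) ^ e ≤ c := fun e => h e _ (hν e).1
  have htend := tendsto_atTop_ciSup hmono ⟨c, by rintro _ ⟨e, rfl⟩; exact hbound e⟩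
  exact ⟨_, ⟨ν, hν, htend⟩, le_of_tendsto' htend hbound⟩

end FThreshold

end PathPacking

theorem mainTheorem2 {n : ℕ} (G : SimpleGraph (Fin n)) :
    -- the integer optimum equals `r(G)` and the binomial grade of `J_G`
    (∃ r : ℕ, IsGreatest (PathPacking.semiPathSizes G) r ∧
      IsGreatest (PathPacking.ppValues G ℤ) (r : ℤ) ∧
      ∀ (K : Type u) [Field K], IsGreatest
        (PathPacking.binomialRegularLengths (PathPacking.binomialEdgeIdeal K G)) r) ∧
    -- the integer dual optimum equals the height of `J_G`
    (∃ h : ℕ, IsLeast (PathPacking.ppDualValues G ℤ) (h : ℤ) ∧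
      ∀ (K : Type u) [Field K], (PathPacking.binomialEdgeIdeal K G).height = (h : ℕ∞)) ∧
    -- the rational optima of the two programs agree and bound all F-thresholds of `J_G`
    (∃ q : ℚ, IsGreatest (PathPacking.ppValues G ℚ) q ∧
      IsGreatest (PathPacking.lpValues G ℚ) q ∧
      ∀ (p : ℕ) [Fact p.Prime] (K : Type u) [Field K] [CharP K p],
        ∃ c : ℝ, PathPacking.IsFThreshold p (PathPacking.binomialEdgeIdeal K G) c ∧
          c ≤ (q : ℝ)) := by
  refine ⟨PathPacking.exists_isGreatest_semiPathSizes G,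
    PathPacking.exists_isLeast_ppDualValues_and_height_eq G, ?_⟩
  obtain ⟨q, hq⟩ := PathPacking.ppValues_rat_exists_isGreatest G
  have hq' := hq
  rw [← PathPacking.lpValues_rat_eq_ppValues_rat] at hq'
  refine ⟨q, hq, hq', fun p _ K _ _ => PathPacking.exists_isFThreshold_le p fun e r her => ?_⟩
  have := hq'.2 (PathPacking.div_mem_lpValues p e r her)
  have h := (Rat.cast_le (K := ℝ)).2 this
  push_cast at h
  exact h
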